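/- For every $N\ge 1$ let $W_N>0$ be real with $2W_N\le N$, write $|u-v|_N=\min(|u-v|,\,N-|u-v|)$ for $u,v\in\mathbb{Z}/N\mathbb{Z}=\{0,\dots,N-1\}$, and let $H_N=(H_{uv})$ be an $N\times N$ random Hermitian matrix, with rows and columns labelled by $\mathbb{Z}/N\mathbb{Z}$, whose entries above the main diagonal are independent and satisfy $H_{uv}=0$ if $|u-v|_N>W_N$ or $u=v$. Assume that either (a) (random signs) $\mathbb{P}\{H_{uv}=1\}=\mathbb{P}\{H_{uv}=-1\}=1/2$ for all $N$ and all $u,v$ with $0<|u-v|_N\le W_N$, or (b) (random phases) $H_{uv}$ has the law of $\exp(iU)$ with $U$ uniformly distributed on $(0,2\pi)$, for all $N$ and all $u,v$ with $0<|u-v|_N\le W_N$. If $W_N/\log N\to+\infty$ as $N\to\infty$, then the operator norm (with respect to the Euclidean norm on $\mathbb{C}^N$) $\left\|H_N/(2\sqrt{2W_N})\right\|$ converges in distribution to the constant $1$ as $N\to\infty$. -/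

import Mathlib

open MeasureTheory ProbabilityTheory Filter Topology

/-- The cyclic distance `min (|u - v|, N - |u - v|)` on `ℤ / Nℤ = {0, …, N - 1}`. -/
def cyclicDist {N : ℕ} (u v : Fin N) : ℤ :=
  min |(u : ℤ) - (v : ℤ)| ((N : ℤ) - |(u : ℤ) - (v : ℤ)|)

/-- The law of a random sign: the values `1` and `-1` have probability `1 / 2` each. -/
noncomputable def randomSignLaw : Measure ℂ :=
  (2⁻¹ : ENNReal) • Measure.dirac (1 : ℂ) + (2⁻¹ : ENNReal) • Measure.dirac (-1 : ℂ)

/-- The law of a random phase: the law of `exp (i U)` with `U` uniform on `(0, 2π)`. -/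
noncomputable def randomPhaseLaw : Measure ℂ :=
  (cond (volume : Measure ℝ) (Set.Ioo 0 (2 * Real.pi))).map
    (fun t : ℝ => Complex.exp (Complex.I * (t : ℂ)))

/-- `H` is an `N × N` random Hermitian periodic band matrix of band width `W` on the probability
space `(Ω, P)`, whose entries inside the band have the law `ν`. -/
structure IsRandomBandMatrix {Ω : Type*} [MeasurableSpace Ω] (P : Measure Ω) (ν : Measure ℂ)
    (N : ℕ) (W : ℝ) (H : Ω → Matrix (Fin N) (Fin N) ℂ) : Prop where
  /-- the entries are random variables -/
  measurable_entry : ∀ u v : Fin N, Measurable fun ω => H ω u v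
  /-- the matrix is Hermitian -/
  isHermitian : ∀ ω, (H ω).IsHermitian
  /-- the entries above the main diagonal are independent -/
  indep : iIndepFun
    (fun (p : {p : Fin N × Fin N // p.1 < p.2}) (ω : Ω) => H ω p.1.1 p.1.2) P
  /-- the entries on the diagonal and outside the band vanish -/
  eq_zero : ∀ (ω : Ω) (u v : Fin N), W < (cyclicDist u v : ℝ) ∨ u = v → H ω u v = 0
  /-- the off-diagonal entries inside the band have law `ν` -/
  law : ∀ u v : Fin N, 0 < cyclicDist u v → (cyclicDist u v : ℝ) ≤ W →
    P.map (fun ω => H ω u v) = ν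

/-- The operator norm of a complex matrix on `ℂ ^ N` with the Euclidean norm. -/
noncomputable def euclideanOpNorm {N : ℕ} (A : Matrix (Fin N) (Fin N) ℂ) : ℝ :=
  ‖Matrix.toEuclideanCLM (n := Fin N) (𝕜 := ℂ) A‖

/-! The norm is squeezed between two moment estimates, with s = √(2W), so that s² is essentially the
degree of the band graph. The expectation of a product of entries along a walk is 0 or 1, and it
vanishes unless every edge is traversed an even number of times. Moments therefore count closed
walks. They are computed step by step (`walkSum`), and the walk so far matters mainly through the
set O of edges traversed an odd number of times.

Upper bound: `walkSum_le` gives a supersolution of this recursion. With K a bound on the length, n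
more steps contribute at most (s(2 + 6K/s²))^n s^(-|O|) times `excessWeight`. Opening an edge to a
new vertex and closing an odd edge contribute s each; opening an edge to a visited vertex
contributes only 6K/s. Hence E tr H^n ≤ N (2s)^n (1 + 3n/s²)^n. As W/log N → ∞, one can take n of
order log N, large enough that (1 + ε)^n beats N, while n/s² stays small. Markov's inequality
concludes.

Lower bound: a fixed exponent m = 2k suffices. Walks that cancel as on a tree give E (H^m)_rr ≥ s'^m
Cat_k with s'² = 2W - 4 (`le_walkSum`). Leaving the tree-like regime costs a factor 1/s², so E
(H^m)_rr² ≤ s^(2m) (Cat_k² + O(1/s²)), by `walkSum_le_ballot` used twice. Chebyshev's inequality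
keeps (H^m)_rr near s^m Cat_k; it is at most ‖H‖^m, and Cat_k^(1/2k) → 2. -/

/-! ### Ballot numbers and the growth of the Catalan numbers -/

/-- The number of walks on `ℕ` with `n` steps `± 1` from `h` to `0`. -/
def ballot : ℕ → ℕ → ℕ
  | 0, 0 => 1
  | 0, _ + 1 => 0
  | n + 1, 0 => ballot n 1
  | n + 1, h + 1 => ballot n (h + 2) + ballot n h

theorem ballot_self (h : ℕ) : ballot h h = 1 ∧ ∀ k, h < k → ballot h k = 0 := by
  induction h with
  | zero => exact ⟨rfl, fun k hk => by obtain ⟨k, rfl⟩ := Nat.exists_eq_succ_of_ne_zero hk.ne'; rfl⟩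
  | succ h ih =>
    refine ⟨by rw [ballot, ih.1, ih.2 _ (by omega)], fun k hk => ?_⟩
    obtain ⟨k, rfl⟩ := Nat.exists_eq_succ_of_ne_zero (by omega : k ≠ 0)
    rw [ballot, ih.2 _ (by omega), ih.2 _ (by omega)]

/-- The reflection formula, obtained from Pascal's rule. It is additive to avoid truncated
subtraction; paths without up-steps are left to `ballot_self`. -/
theorem ballot_add_choose (j h : ℕ) :
    ballot (h + 2 * (j + 1)) h + (h + 2 * (j + 1)).choose j = (h + 2 * (j + 1)).choose (j + 1) := by
  induction j generalizing h with
  | zero =>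
    induction h with
    | zero => simp [ballot]
    | succ h ih =>
      have e : h + 1 + 2 * (0 + 1) = (h + 2) + 1 := by ring
      rw [e, ballot, (ballot_self _).1]
      simp at ih ⊢
      omega
  | succ j ihj =>
    induction h with
    | zero =>
      have e : 0 + 2 * (j + 1 + 1) = (1 + 2 * (j + 1)) + 1 := by ring
      have h1 := ihj 1
      rw [e, ballot, Nat.choose_succ_succ', Nat.choose_succ_succ' _ (j + 1)]
      have h2 : (1 + 2 * (j + 1)).choose (j + 1 + 1) = (1 + 2 * (j + 1)).choose (j + 1) :=
        Nat.choose_symm_of_eq_add (by ring)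
      omega
    | succ h ih =>
      have e : h + 1 + 2 * (j + 1 + 1) = (h + 2 * (j + 1 + 1)) + 1 := by ring
      have e' : h + 2 + 2 * (j + 1) = h + 2 * (j + 1 + 1) := by ring
      have h1 := ihj (h + 2)
      rw [e'] at h1
      rw [e, ballot, Nat.choose_succ_succ', Nat.choose_succ_succ' _ (j + 1)]
      omega

theorem succ_mul_ballot (k : ℕ) : (k + 1) * ballot (2 * k) 0 = k.centralBinom := by
  rcases k with _ | k
  · simp [ballot]
  have h := ballot_add_choose k 0
  rw [zero_add] at h
  have h2 := Nat.choose_succ_right_eq (2 * (k + 1)) k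
  rw [show 2 * (k + 1) - k = k + 2 by omega] at h2
  rw [Nat.centralBinom]
  nlinarith

/-- The exponential growth rate of the Catalan numbers is `4`. -/
theorem exists_lt_ballot {l : ℝ} (hl0 : 0 < l) (hl : l < 1) :
    ∃ k : ℕ, 4 * (4 * l) ^ k ≤ (ballot (2 * k) 0 : ℝ) := by
  have h1 : Tendsto (fun k : ℕ => (k : ℝ) ^ 2 * l ^ k) atTop (𝓝 0) :=
    tendsto_pow_const_mul_const_pow_of_lt_one 2 hl0.le hl
  obtain ⟨k, hk, hk4⟩ := ((h1.eventually_lt_const (by norm_num : (0 : ℝ) < 1 / 8)).and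
    (eventually_ge_atTop 4)).exists
  refine ⟨k, ?_⟩
  have hb : ((k : ℝ) + 1) * ballot (2 * k) 0 = k.centralBinom := by exact_mod_cast succ_mul_ballot k
  have h4 : (4 : ℝ) ^ k < k * k.centralBinom := by
    exact_mod_cast Nat.four_pow_lt_mul_centralBinom k hk4
  have hk' : (4 : ℝ) ≤ k := by exact_mod_cast hk4
  rw [mul_pow]
  have h5 : (4 : ℝ) ^ k < 2 * k ^ 2 * ballot (2 * k) 0 := by
    rw [← hb] at h4
    have : (0 : ℝ) ≤ ballot (2 * k) 0 := by positivity
    nlinarith [mul_nonneg this (by positivity : (0 : ℝ) ≤ k),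
      mul_nonneg (mul_nonneg this (by positivity : (0 : ℝ) ≤ k)) (by linarith : (0 : ℝ) ≤ (k : ℝ) - 1)]
  have hlk : (0 : ℝ) < l ^ k := by positivity
  have h6 : (4 : ℝ) ^ k * l ^ k ≤ 2 * k ^ 2 * ballot (2 * k) 0 * l ^ k :=
    mul_le_mul_of_nonneg_right h5.le hlk.le
  have : (0 : ℝ) ≤ ballot (2 * k) 0 := by positivity
  nlinarith

/-! ### Odd edges of a walk and the supersolution -/

section Walks

set_option linter.unusedSectionVars false

variable {V : Type*} [DecidableEq V]

/-- The undirected edges that are traversed an odd number of times by a list of steps. -/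
def oddEdges : List (V × V) → Finset (Sym2 V)
  | [] => ∅
  | p :: L => symmDiff (oddEdges L) {s(p.1, p.2)}

/-- The vertices visited by a list of steps that starts at `r`. -/
def visited (r : V) : List (V × V) → Finset V
  | [] => {r}
  | p :: L => insert p.2 (visited r L)

/-- The list of steps `L`, with the last step first, is a walk from `r` to `u`. -/
def IsWalk (nbr : V → Finset V) (r : V) : List (V × V) → V → Prop
  | [], u => u = r
  | p :: L, u => p.2 = u ∧ p.2 ∈ nbr p.1 ∧ IsWalk nbr r L p.1

/-- The sum of `base` over all extensions by `n` steps of the walk `L`, which ends at `u`. -/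
def walkSum (nbr : V → Finset V) (base : List (V × V) → V → ℝ) : ℕ → List (V × V) → V → ℝ
  | 0, L, u => base L u
  | n + 1, L, u => ∑ x ∈ nbr u, walkSum nbr base n ((u, x) :: L) x

/-- The degree of `v` in the edge set `O`, to which a half-edge is attached at the root `r`. -/
def rootedDegree (r : V) (O : Finset (Sym2 V)) (v : V) : ℕ :=
  (O.filter (fun e => v ∈ e)).card + if v = r then 1 else 0

/-- The number of additional strands of `O` that pass through `v`. -/
def excess (r : V) (O : Finset (Sym2 V)) (v : V) : ℕ := (rootedDegree r O v - 1) / 2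

/-- The weight of an edge set in the supersolution of the walk recursion. -/
noncomputable def excessWeight [Fintype V] (r : V) (O : Finset (Sym2 V)) : ℝ :=
  ∏ v, ((excess r O v).factorial : ℝ) * 3 ^ excess r O v

theorem oddEdges_cons_of_notMem {L : List (V × V)} {u x : V} (h : s(u, x) ∉ oddEdges L) :
    oddEdges ((u, x) :: L) = insert s(u, x) (oddEdges L) := by
  ext e
  simp only [oddEdges, Finset.mem_symmDiff, Finset.mem_singleton, Finset.mem_insert]
  grind

theorem oddEdges_cons_of_mem {L : List (V × V)} {u x : V} (h : s(u, x) ∈ oddEdges L) :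
    oddEdges ((u, x) :: L) = (oddEdges L).erase s(u, x) := by
  ext e
  simp only [oddEdges, Finset.mem_symmDiff, Finset.mem_singleton, Finset.mem_erase]
  grind

theorem rootedDegree_insert {r : V} {O : Finset (Sym2 V)} {e : Sym2 V} (he : e ∉ O) (v : V) :
    rootedDegree r (insert e O) v = rootedDegree r O v + if v ∈ e then 1 else 0 := by
  unfold rootedDegree
  rw [Finset.filter_insert]
  split_ifs with h1
  · rw [Finset.card_insert_of_notMem (by simp [he]), add_right_comm]
  · rw [Finset.card_insert_of_notMem (by simp [he])]
  · rfl
  · rfl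

theorem rootedDegree_erase {r : V} {O : Finset (Sym2 V)} {e : Sym2 V} (he : e ∈ O) (v : V) :
    rootedDegree r (O.erase e) v + (if v ∈ e then 1 else 0) = rootedDegree r O v := by
  rw [← rootedDegree_insert (Finset.notMem_erase e O), Finset.insert_erase he]

theorem length_oddEdges_le (L : List (V × V)) : (oddEdges L).card ≤ L.length := by
  induction L with
  | nil => simp [oddEdges]
  | cons p L ih =>
    obtain ⟨a, b⟩ := p
    by_cases h : s(a, b) ∈ oddEdges L
    · rw [oddEdges_cons_of_mem h]
      have := Finset.card_erase_le (a := s(a, b)) (s := oddEdges L)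
      simp; omega
    · rw [oddEdges_cons_of_notMem h, Finset.card_insert_of_notMem h]
      simpa

theorem card_visited_le (r : V) (L : List (V × V)) : (visited r L).card ≤ L.length + 1 := by
  induction L with
  | nil => simp [visited]
  | cons p L ih =>
    have := Finset.card_insert_le p.2 (visited r L)
    simp only [visited, List.length_cons]
    omega

namespace IsWalk

variable {nbr : V → Finset V} {r : V}

theorem cons {L : List (V × V)} {u x : V} (h : IsWalk nbr r L u) (hx : x ∈ nbr u) :
    IsWalk nbr r ((u, x) :: L) x := ⟨rfl, hx, h⟩

theorem mem_visited {L : List (V × V)} {u : V} (h : IsWalk nbr r L u) : u ∈ visited r L := by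
  cases L with
  | nil =>
    have : u = r := h
    simp [visited, this]
  | cons p L => simp [visited, h.1]

theorem root_mem_visited (L : List (V × V)) : r ∈ visited r L := by
  induction L with
  | nil => simp [visited]
  | cons p L ih => simp [visited, ih]

theorem mem_visited_of_mem {L : List (V × V)} {u : V} (h : IsWalk nbr r L u)
    {e : Sym2 V} (he : e ∈ oddEdges L) {v : V} (hv : v ∈ e) : v ∈ visited r L := by
  induction L generalizing u with
  | nil => simp [oddEdges] at he
  | cons p L ih =>
    obtain ⟨h1, h2, h3⟩ := h
    simp only [oddEdges, Finset.mem_symmDiff, Finset.mem_singleton] at he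
    simp only [visited, Finset.mem_insert]
    rcases he with he | he
    · exact Or.inr (ih h3 he.1)
    · rw [he.1, Sym2.mem_iff] at hv
      rcases hv with rfl | rfl
      · exact Or.inr h3.mem_visited
      · exact Or.inl rfl

theorem rootedDegree_eq_zero {L : List (V × V)} {u : V} (h : IsWalk nbr r L u) {v : V}
    (hv : v ∉ visited r L) : rootedDegree r (oddEdges L) v = 0 := by
  have hr : v ≠ r := fun e => hv (e ▸ root_mem_visited L)
  simp only [rootedDegree, hr, if_false, add_zero, Finset.card_eq_zero]
  exact Finset.filter_eq_empty_iff.2 fun e he hve => hv (h.mem_visited_of_mem he hve)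

/-- A step toggles the parity at its two ends. The half-edge at the root makes the current endpoint
the only odd vertex, even when the walk is closed. -/
theorem odd_rootedDegree (hl : ∀ u, u ∉ nbr u) {L : List (V × V)} {u : V}
    (h : IsWalk nbr r L u) (v : V) : Odd (rootedDegree r (oddEdges L) v) ↔ v = u := by
  induction L generalizing u with
  | nil =>
    have : u = r := h
    subst this
    simp [oddEdges, rootedDegree]
    split_ifs <;> simp_all
  | cons p L ih =>
    obtain ⟨a, b⟩ := p
    obtain ⟨h1, h2, h3⟩ := h
    simp only at h1 h2 h3
    subst h1
    have hab : a ≠ b := fun e => hl a (by simpa [e] using h2)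
    have ih' := ih h3
    by_cases hm : s(a, b) ∈ oddEdges L
    · have := rootedDegree_erase (r := r) hm v
      rw [oddEdges_cons_of_mem hm]
      simp only [Sym2.mem_iff] at this
      by_cases hva : v = a
      · subst hva
        simp only [true_or, if_true] at this
        have h5 := ih'.2 rfl
        simp only [hab, iff_false]
        rw [← this] at h5
        grind
      · by_cases hvb : v = b
        · subst hvb
          simp only [or_true, if_true] at this
          simp only [iff_true]
          simp only [hva, iff_false] at ih'
          rw [← this] at ih'
          grind
        · simp only [hva, hvb, or_self, if_false, add_zero] at this
          rw [this, ih']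
          simp [hva, hvb]
    · have := rootedDegree_insert (r := r) hm v
      rw [oddEdges_cons_of_notMem hm, this]
      simp only [Sym2.mem_iff]
      by_cases hva : v = a
      · subst hva
        have h5 := ih'.2 rfl
        simp only [true_or, if_true, hab, iff_false]
        grind
      · by_cases hvb : v = b
        · subst hvb
          simp only [hva, iff_false] at ih'
          simp only [or_true, if_true, iff_true]
          grind
        · simp [hva, hvb, ih']

/-- At u the degree goes from 2b + 1 to 2b + 2, which leaves (d - 1) / 2 unchanged. At x it goes
from 2m to 2m + 1, a gain of one unless m = 0, where truncated subtraction already gives 0. -/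
theorem excess_insert (hl : ∀ u, u ∉ nbr u) {L : List (V × V)} {u x : V}
    (h : IsWalk nbr r L u) (hx : x ∈ nbr u) (he : s(u, x) ∉ oddEdges L) :
    excess r (insert s(u, x) (oddEdges L)) =
      if rootedDegree r (oddEdges L) x = 0 then excess r (oddEdges L)
      else Function.update (excess r (oddEdges L)) x (excess r (oddEdges L) x + 1) := by
  have hux : x ≠ u := fun e => hl u (by simpa [e] using hx)
  have hu := (h.odd_rootedDegree hl u).2 rfl
  have hx' := (h.odd_rootedDegree hl x).not.2 hux
  rw [Nat.odd_iff] at hu hx'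
  funext v
  have hv := rootedDegree_insert (r := r) he v
  simp only [Sym2.mem_iff] at hv
  split_ifs with h0
  · unfold excess
    by_cases hvu : v = u
    · subst hvu
      simp only [true_or, if_true] at hv
      omega
    · by_cases hvx : v = x
      · subst hvx
        simp only [or_true, if_true] at hv
        omega
      · simp only [hvu, hvx, or_self, if_false, add_zero] at hv
        rw [hv]
  · by_cases hvx : v = x
    · subst hvx
      rw [Function.update_self]
      unfold excess
      simp only [or_true, if_true] at hv
      omega
    · rw [Function.update_of_ne hvx]
      unfold excess
      by_cases hvu : v = u
      · subst hvu
        simp only [true_or, if_true] at hv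
        omega
      · simp only [hvu, hvx, or_self, if_false, add_zero] at hv
        rw [hv]

/-- Here x has even degree at least 2, so losing one edge does not change its excess; only the odd
vertex u pays. -/
theorem excess_erase (hl : ∀ u, u ∉ nbr u) {L : List (V × V)} {u x : V}
    (h : IsWalk nbr r L u) (hx : x ∈ nbr u) (he : s(u, x) ∈ oddEdges L) :
    excess r ((oddEdges L).erase s(u, x)) =
      Function.update (excess r (oddEdges L)) u (excess r (oddEdges L) u - 1) := by
  have hux : x ≠ u := fun e => hl u (by simpa [e] using hx)
  have hu := (h.odd_rootedDegree hl u).2 rfl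
  have hx' := (h.odd_rootedDegree hl x).not.2 hux
  rw [Nat.odd_iff] at hu hx'
  funext v
  have hv := rootedDegree_erase (r := r) he v
  simp only [Sym2.mem_iff] at hv
  by_cases hvu : v = u
  · subst hvu
    rw [Function.update_self]
    unfold excess
    simp only [true_or, if_true] at hv
    omega
  · rw [Function.update_of_ne hvu]
    unfold excess
    by_cases hvx : v = x
    · subst hvx
      simp only [or_true, if_true] at hv
      omega
    · simp only [hvu, hvx, or_self, if_false, add_zero] at hv
      rw [hv]

end IsWalk

variable [Fintype V]

theorem excessWeight_pos (r : V) (O : Finset (Sym2 V)) : 0 < excessWeight r O :=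
  Finset.prod_pos fun v _ => by positivity

theorem one_le_excessWeight (r : V) (O : Finset (Sym2 V)) : 1 ≤ excessWeight r O := by
  rw [← Finset.prod_const_one (s := (Finset.univ : Finset V))]
  exact Finset.prod_le_prod (fun _ _ => zero_le_one) fun v _ => one_le_mul_of_one_le_of_one_le
    (by exact_mod_cast Nat.succ_le_of_lt (Nat.factorial_pos _)) (one_le_pow₀ (by norm_num))

namespace IsWalk

variable {nbr : V → Finset V} {r : V}

theorem excessWeight_insert_of_notMem_visited (hl : ∀ u, u ∉ nbr u) {L : List (V × V)} {u x : V}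
    (h : IsWalk nbr r L u) (hx : x ∈ nbr u) (he : s(u, x) ∉ oddEdges L)
    (hv : x ∉ visited r L) :
    excessWeight r (insert s(u, x) (oddEdges L)) = excessWeight r (oddEdges L) := by
  rw [excessWeight, h.excess_insert hl hx he, if_pos (h.rootedDegree_eq_zero hv), excessWeight]

theorem excessWeight_insert_le (hl : ∀ u, u ∉ nbr u) {L : List (V × V)} {u x : V}
    (h : IsWalk nbr r L u) (hx : x ∈ nbr u) (he : s(u, x) ∉ oddEdges L) :
    excessWeight r (insert s(u, x) (oddEdges L)) ≤
      3 * (excess r (oddEdges L) x + 1) * excessWeight r (oddEdges L) := by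
  rw [excessWeight, h.excess_insert hl hx he]
  split_ifs with h0
  · have := excessWeight_pos r (oddEdges L)
    rw [← excessWeight]
    have h1 : (0 : ℝ) ≤ excess r (oddEdges L) x := by positivity
    nlinarith [mul_nonneg h1 this.le]
  · refine le_of_eq ?_
    rw [excessWeight, ← Finset.mul_prod_erase _ _ (Finset.mem_univ x),
      ← Finset.mul_prod_erase _ _ (Finset.mem_univ x), Function.update_self,
      Nat.factorial_succ, pow_succ]
    rw [Finset.prod_congr rfl fun v hv => by rw [Function.update_of_ne (Finset.ne_of_mem_erase hv)]]
    push_cast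
    ring

/-- Lowering the excess from b to b - 1 divides the weight by 3b ≥ 2b + 1 if b ≥ 1; for b = 0
nothing is needed. This is why the base 3 appears in `excessWeight`: the gain offsets the number of
closing moves bounded in `card_closing_le`. -/
theorem excessWeight_erase_le (hl : ∀ u, u ∉ nbr u) {L : List (V × V)} {u x : V}
    (h : IsWalk nbr r L u) (hx : x ∈ nbr u) (he : s(u, x) ∈ oddEdges L) :
    excessWeight r ((oddEdges L).erase s(u, x)) ≤
      excessWeight r (oddEdges L) / (2 * excess r (oddEdges L) u + 1) := by
  rw [le_div_iff₀ (by positivity), excessWeight, excessWeight, h.excess_erase hl hx he,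
    ← Finset.mul_prod_erase _ _ (Finset.mem_univ u),
    ← Finset.mul_prod_erase _ _ (Finset.mem_univ u), Function.update_self]
  rw [Finset.prod_congr rfl fun v hv => by rw [Function.update_of_ne (Finset.ne_of_mem_erase hv)]]
  have hp : 0 ≤ ∏ v ∈ Finset.univ.erase u,
      ((excess r (oddEdges L) v).factorial : ℝ) * 3 ^ excess r (oddEdges L) v := by positivity
  rw [mul_right_comm]
  refine mul_le_mul_of_nonneg_right ?_ hp
  rcases excess r (oddEdges L) u with _ | b
  · simp
  · rw [Nat.add_sub_cancel, Nat.factorial_succ, pow_succ]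
    push_cast
    have : (0 : ℝ) ≤ (b.factorial : ℝ) * 3 ^ b := by positivity
    have hb : (0 : ℝ) ≤ b := by positivity
    nlinarith [mul_nonneg this hb]

/-- The rooted degree of the endpoint is odd, hence exactly 2b + 1, and it bounds the number of odd
edges at u. -/
theorem card_closing_le (hl : ∀ u, u ∉ nbr u) {L : List (V × V)} {u : V}
    (h : IsWalk nbr r L u) :
    ((nbr u).filter (fun x => s(u, x) ∈ oddEdges L)).card ≤ 2 * excess r (oddEdges L) u + 1 := by
  have hu := (h.odd_rootedDegree hl u).2 rfl
  have h1 : ((nbr u).filter (fun x => s(u, x) ∈ oddEdges L)).card ≤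
      ((oddEdges L).filter (fun e => u ∈ e)).card := by
    refine Finset.card_le_card_of_injOn (fun x => s(u, x)) ?_ ?_
    · intro x hx
      simp at hx ⊢
      exact hx.2
    · intro x _ y _ hxy
      exact Sym2.congr_right.1 hxy
  have h2 : ((oddEdges L).filter (fun e => u ∈ e)).card ≤ rootedDegree r (oddEdges L) u :=
    Nat.le_add_right _ _
  refine h1.trans (h2.trans ?_)
  unfold excess
  grind

/-- Handshake: the half-edge adds one to the total degree 2|O|, and twice the excess is at most the
degree. -/
theorem sum_excess_le (r : V) (O : Finset (Sym2 V)) : ∑ v, excess r O v ≤ O.card := by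
  have h1 : ∑ v, rootedDegree r O v ≤ 2 * O.card + 1 := by
    simp only [rootedDegree, Finset.sum_add_distrib, Finset.sum_ite_eq', Finset.mem_univ, if_true]
    refine Nat.add_le_add_right ?_ 1
    simp only [Finset.card_filter]
    rw [Finset.sum_comm, mul_comm, ← smul_eq_mul, ← Finset.sum_const]
    refine Finset.sum_le_sum fun e _ => ?_
    rw [← Finset.card_filter]
    induction e with
    | _ a b =>
      refine (Finset.card_le_card (t := {a, b}) ?_).trans Finset.card_le_two
      intro v
      simp
  have h2 : 2 * ∑ v, excess r O v ≤ ∑ v, rootedDegree r O v := by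
    rw [Finset.mul_sum]
    exact Finset.sum_le_sum fun v _ => by unfold excess; omega
  omega

theorem sum_visited_le (r : V) (L : List (V × V)) :
    ∑ x ∈ visited r L, (3 * (excess r (oddEdges L) x + 1) : ℝ) ≤ 6 * (L.length + 1) := by
  have h1 : ∑ x ∈ visited r L, (excess r (oddEdges L) x + 1) ≤ 2 * (L.length + 1) := by
    rw [Finset.sum_add_distrib, Finset.sum_const, smul_eq_mul, mul_one]
    have h2 := (Finset.sum_le_univ_sum_of_nonneg (s := visited r L)
      (f := excess r (oddEdges L)) fun _ => Nat.zero_le _).trans (sum_excess_le r (oddEdges L))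
    have h3 := length_oddEdges_le L
    have h4 := card_visited_le r L
    omega
  rw [← Finset.mul_sum]
  have : ∑ x ∈ visited r L, ((excess r (oddEdges L) x : ℝ) + 1) ≤ 2 * (L.length + 1) := by
    exact_mod_cast h1
  linarith

end IsWalk

/-- Walks that have to close every edge are dominated by a supersolution of the walk recursion. -/
theorem walkSum_le {nbr : V → Finset V} (hl : ∀ u, u ∉ nbr u) {s : ℝ} (hs : 0 < s)
    (hcard : ∀ u, ((nbr u).card : ℝ) ≤ s ^ 2) (r : V) (K : ℕ) {base : List (V × V) → V → ℝ} {c : ℝ}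
    (hc : 0 ≤ c)
    (hbase : ∀ L u, IsWalk nbr r L u → L.length ≤ K →
      base L u ≤ c / s ^ (oddEdges L).card * excessWeight r (oddEdges L))
    (n : ℕ) (L : List (V × V)) (u : V) (hw : IsWalk nbr r L u) (hK : L.length + n ≤ K) :
    walkSum nbr base n L u ≤ c * (2 + 6 * K / s ^ 2) ^ n * s ^ n / s ^ (oddEdges L).card *
      excessWeight r (oddEdges L) := by
  induction n generalizing L u with
  | zero => simpa [walkSum] using hbase L u hw (by simpa using hK)
  | succ n ih =>
    rw [walkSum]
    -- t is the total gain per step divided by s: 1 for new vertices, 1 for closing moves, 6K/s² for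
    -- returns to visited vertices.
    set t : ℝ := 2 + 6 * K / s ^ 2 with ht
    have ht0 : 0 < t := by positivity
    set w := excessWeight r (oddEdges L) with hwdef
    have hw0 : 0 < w := excessWeight_pos _ _
    set X : ℝ := c * t ^ n * s ^ n / s ^ (oddEdges L).card * w with hX
    have hX0 : 0 ≤ X := by positivity
    set b := excess r (oddEdges L) u with hb
    have key : ∀ x ∈ nbr u, walkSum nbr base n ((u, x) :: L) x ≤
        X / s + (if x ∈ visited r L then X / s * (3 * (excess r (oddEdges L) x + 1)) else 0) +
        (if s(u, x) ∈ oddEdges L then X * s / (2 * b + 1) else 0) := by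
      intro x hx
      have h1 := ih ((u, x) :: L) x (hw.cons hx) (by simp; omega)
      refine h1.trans ?_
      have hv0 : 0 ≤ (if x ∈ visited r L then X / s * (3 * (excess r (oddEdges L) x + 1)) else 0) := by
        split_ifs <;> positivity
      have hXs : 0 ≤ X / s := by positivity
      by_cases he : s(u, x) ∈ oddEdges L
      · rw [oddEdges_cons_of_mem he, if_pos he, Finset.card_erase_of_mem he]
        obtain ⟨m, hm⟩ := Nat.exists_eq_succ_of_ne_zero
          (Finset.card_ne_zero_of_mem he)
        have h2 := hw.excessWeight_erase_le hl hx he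
        have h3 : c * t ^ n * s ^ n / s ^ ((oddEdges L).card - 1) *
            excessWeight r ((oddEdges L).erase s(u, x)) ≤
            c * t ^ n * s ^ n / s ^ ((oddEdges L).card - 1) * (w / (2 * b + 1)) :=
          mul_le_mul_of_nonneg_left h2 (by positivity)
        have h4 : c * t ^ n * s ^ n / s ^ ((oddEdges L).card - 1) * (w / (2 * b + 1)) =
            X * s / (2 * b + 1) := by
          rw [hX, hm, Nat.succ_sub_one, Nat.succ_eq_add_one, pow_succ s m]
          field_simp
        linarith
      · rw [oddEdges_cons_of_notMem he, if_neg he, Finset.card_insert_of_notMem he]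
        have h4 : c * t ^ n * s ^ n / s ^ ((oddEdges L).card + 1) * w = X / s := by
          rw [hX, pow_succ]; field_simp
        by_cases hv : x ∈ visited r L
        · rw [if_pos hv]
          have h2 := hw.excessWeight_insert_le hl hx he
          have h3 := mul_le_mul_of_nonneg_left h2
            (by positivity : 0 ≤ c * t ^ n * s ^ n / s ^ ((oddEdges L).card + 1))
          rw [mul_left_comm, h4] at h3
          linarith
        · rw [if_neg hv, hw.excessWeight_insert_of_notMem_visited hl hx he hv, ← hwdef, h4]
          simp
    refine (Finset.sum_le_sum key).trans ?_
    rw [Finset.sum_add_distrib, Finset.sum_add_distrib, Finset.sum_const, nsmul_eq_mul]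
    have e1 : ((nbr u).card : ℝ) * (X / s) ≤ X * s := by
      have := mul_le_mul_of_nonneg_right (hcard u) (by positivity : 0 ≤ X / s)
      refine this.trans_eq ?_
      field_simp
    -- Returns are rare: the sum runs over the visited vertices, not over the s² neighbours.
    have e2 : ∑ x ∈ nbr u, (if x ∈ visited r L then X / s * (3 * (excess r (oddEdges L) x + 1))
        else (0 : ℝ)) ≤ X / s * (6 * K) := by
      rw [← Finset.sum_filter]
      refine (Finset.sum_le_sum_of_subset_of_nonneg (t := visited r L) ?_ ?_).trans ?_
      · intro x hx; exact (Finset.mem_filter.1 hx).2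
      · intro x _ _; positivity
      · rw [← Finset.mul_sum]
        refine mul_le_mul_of_nonneg_left ((IsWalk.sum_visited_le r L).trans ?_) (by positivity)
        have : (L.length : ℝ) + 1 ≤ K := by exact_mod_cast (by omega : L.length + 1 ≤ K)
        linarith
    have e3 : ∑ x ∈ nbr u, (if s(u, x) ∈ oddEdges L then X * s / (2 * b + 1) else (0 : ℝ)) ≤
        X * s := by
      rw [← Finset.sum_filter, Finset.sum_const, nsmul_eq_mul]
      have h1 : (((nbr u).filter (fun x => s(u, x) ∈ oddEdges L)).card : ℝ) ≤ 2 * b + 1 := by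
        exact_mod_cast hw.card_closing_le hl
      have := mul_le_mul_of_nonneg_right h1 (by positivity : 0 ≤ X * s / (2 * b + 1))
      refine this.trans_eq ?_
      field_simp
    have e4 : c * t ^ (n + 1) * s ^ (n + 1) / s ^ (oddEdges L).card * w =
        X * s + X / s * (6 * K) + X * s := by
      rw [hX, pow_succ t, pow_succ s n]
      have : t * s = s + 6 * K / s + s := by rw [ht]; field_simp; ring
      calc _ = c * t ^ n * s ^ n / s ^ (oddEdges L).card * w * (t * s) := by field_simp
        _ = _ := by rw [this]; ring
    rw [e4]
    exact add_le_add (add_le_add e1 e2) e3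

end Walks

/-! ### Tree-like walks: odd edges forming a simple path -/

section Stacks

set_option linter.unusedSectionVars false

variable {V : Type*} [DecidableEq V]

/-- The edges of a path that is given by its list of vertices. -/
def pathEdges : List V → Finset (Sym2 V)
  | [] => ∅
  | [_] => ∅
  | a :: b :: q => insert s(a, b) (pathEdges (b :: q))

/-- The odd edges of the walk `L` from `r` to `u` form the simple path `u :: q` from `u` to `r`,
and no vertex has a positive excess. -/
structure IsStack (r : V) (L : List (V × V)) (u : V) (q : List V) : Prop where
  nodup : (u :: q).Nodup
  last : (u :: q).getLast (List.cons_ne_nil u q) = r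
  oddEdges_eq : oddEdges L = pathEdges (u :: q)
  excess_eq : ∀ v, excess r (oddEdges L) v = 0
  visited : ∀ v ∈ u :: q, v ∈ visited r L

theorem mem_of_mem_pathEdges {p : List V} {e : Sym2 V} (he : e ∈ pathEdges p) {v : V}
    (hv : v ∈ e) : v ∈ p := by
  induction p with
  | nil => simp [pathEdges] at he
  | cons a p ih =>
    cases p with
    | nil => simp [pathEdges] at he
    | cons b q =>
      rw [pathEdges, Finset.mem_insert] at he
      rcases he with rfl | he
      · rw [Sym2.mem_iff] at hv
        rcases hv with rfl | rfl <;> simp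
      · exact List.mem_cons_of_mem _ (ih he)

theorem notMem_pathEdges {a b : V} {q : List V} (h : (a :: q).Nodup) :
    s(a, b) ∉ pathEdges q := fun he =>
  (List.nodup_cons.1 h).1 (mem_of_mem_pathEdges he (Sym2.mem_mk_left a b))

theorem card_pathEdges {u : V} {q : List V} (h : (u :: q).Nodup) :
    (pathEdges (u :: q)).card = q.length := by
  induction q generalizing u with
  | nil => simp [pathEdges]
  | cons b q ih =>
    rw [pathEdges, Finset.card_insert_of_notMem (notMem_pathEdges h), ih (List.nodup_cons.1 h).2]
    simp

/-- On a simple path, the end u lies only on the first edge, so the only closing move is a step back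
along the path. -/
theorem exists_eq_cons_of_mem_pathEdges {u x : V} {q : List V} (h : (u :: q).Nodup)
    (hx : s(u, x) ∈ pathEdges (u :: q)) : ∃ q', q = x :: q' := by
  cases q with
  | nil => simp [pathEdges] at hx
  | cons b q =>
    rw [pathEdges, Finset.mem_insert] at hx
    rcases hx with hx | hx
    · exact ⟨q, by rw [Sym2.congr_right.1 hx]⟩
    · exact absurd hx (notMem_pathEdges h)

namespace IsStack

variable {nbr : V → Finset V} {r : V}

theorem nil (r : V) : IsStack r [] r [] where
  nodup := by simp
  last := by simp
  oddEdges_eq := by simp [oddEdges, pathEdges]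
  excess_eq v := by
    simp only [oddEdges, excess, rootedDegree]
    split_ifs <;> simp
  visited v hv := by simpa [_root_.visited] using hv

theorem eq_nil {L : List (V × V)} {q : List V} (h : IsStack r L r q) : q = [] := by
  cases q with
  | nil => rfl
  | cons b q =>
    have h1 := h.last
    rw [List.getLast_cons (List.cons_ne_nil b q)] at h1
    have h2 := List.getLast_mem (List.cons_ne_nil b q)
    rw [h1] at h2
    exact absurd h2 (List.nodup_cons.1 h.nodup).1

theorem push (hl : ∀ u, u ∉ nbr u) {L : List (V × V)} {u x : V} {q : List V}
    (h : IsStack r L u q) (hw : IsWalk nbr r L u) (hx : x ∈ nbr u) (hv : x ∉ _root_.visited r L) :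
    IsStack r ((u, x) :: L) x (u :: q) := by
  have he : s(u, x) ∉ oddEdges L := fun he =>
    hv (hw.mem_visited_of_mem he (Sym2.mem_mk_right u x))
  refine ⟨List.nodup_cons.2 ⟨fun hm => hv (h.visited x hm), h.nodup⟩, ?_, ?_, fun v => ?_, ?_⟩
  · rw [List.getLast_cons (List.cons_ne_nil u q), h.last]
  · rw [oddEdges_cons_of_notMem he, pathEdges, h.oddEdges_eq, Sym2.eq_swap]
  · rw [oddEdges_cons_of_notMem he, hw.excess_insert hl hx he,
      if_pos (hw.rootedDegree_eq_zero hv), h.excess_eq]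
  · intro v hm
    rw [_root_.visited, Finset.mem_insert]
    rcases List.mem_cons.1 hm with rfl | hm
    · exact Or.inl rfl
    · exact Or.inr (h.visited v hm)

theorem pop (hl : ∀ u, u ∉ nbr u) {L : List (V × V)} {u x : V} {q : List V}
    (h : IsStack r L u (x :: q)) (hw : IsWalk nbr r L u) (hx : x ∈ nbr u) :
    IsStack r ((u, x) :: L) x q := by
  have he : s(u, x) ∈ oddEdges L := by
    rw [h.oddEdges_eq, pathEdges]
    exact Finset.mem_insert_self _ _
  refine ⟨(List.nodup_cons.1 h.nodup).2, ?_, ?_, fun v => ?_, fun v hm => ?_⟩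
  · rw [← h.last, List.getLast_cons (List.cons_ne_nil x q)]
  · rw [oddEdges_cons_of_mem he, h.oddEdges_eq, pathEdges,
      Finset.erase_insert (notMem_pathEdges h.nodup)]
  · rw [oddEdges_cons_of_mem he, hw.excess_erase hl hx he, Function.update_apply]
    split_ifs <;> simp [h.excess_eq]
  · rw [_root_.visited, Finset.mem_insert]
    exact Or.inr (h.visited v (List.mem_cons_of_mem _ hm))

variable [Fintype V]

theorem excessWeight_eq {L : List (V × V)} {u : V} {q : List V} (h : IsStack r L u q) :
    excessWeight r (oddEdges L) = 1 := by
  simp [excessWeight, h.excess_eq]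

theorem card_oddEdges {L : List (V × V)} {u : V} {q : List V} (h : IsStack r L u q) :
    (oddEdges L).card = q.length := by
  rw [h.oddEdges_eq, card_pathEdges h.nodup]

end IsStack

variable [Fintype V]

/-- As long as the odd edges of a walk form a path, the sum over its continuations is, up to a
lower-order term, at most the number of continuations on a tree. -/
theorem walkSum_le_ballot {nbr : V → Finset V} (hl : ∀ u, u ∉ nbr u) {s : ℝ} (hs : 1 ≤ s)
    (hcard : ∀ u, ((nbr u).card : ℝ) ≤ s ^ 2) (r : V) (K : ℕ) {base : List (V × V) → V → ℝ}
    {c c' κ : ℝ} (hc : 0 ≤ c) (hc' : 0 ≤ c') (hκ : 0 ≤ κ)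
    (hbase : ∀ L u, IsWalk nbr r L u → L.length ≤ K →
      base L u ≤ c / s ^ (oddEdges L).card * excessWeight r (oddEdges L))
    (hbase' : ∀ L u q, IsWalk nbr r L u → L.length ≤ K → IsStack r L u q →
      base L u ≤ (c' * ballot 0 q.length + κ / s ^ 2) / s ^ q.length)
    (n : ℕ) (L : List (V × V)) (u : V) (q : List V) (hw : IsWalk nbr r L u)
    (hq : IsStack r L u q) (hK : L.length + n ≤ K) :
    walkSum nbr base n L u ≤ s ^ n / s ^ q.length *
      (c' * ballot n q.length + (κ + n * (3 * K * c)) * (2 + 6 * K) ^ n / s ^ 2) := by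
  have hs0 : 0 < s := by linarith
  induction n generalizing L u q with
  | zero =>
    have := hbase' L u q hw (by simpa using hK) hq
    simp only [walkSum, pow_zero, Nat.cast_zero, zero_mul, add_zero, mul_one]
    rwa [one_div_mul_eq_div]
  | succ n ih =>
    rw [walkSum]
    set T : ℝ := 2 + 6 * K with hT
    have hT2 : 2 ≤ T := by rw [hT]; have : (0 : ℝ) ≤ K := by positivity
                           linarith
    -- E accumulates the errors: one step doubles it (push and pop) and adds 3KcT^n for the exits
    -- from the stack regime.
    set E : ℝ := (κ + n * (3 * K * c)) * T ^ n with hE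
    have hE0 : 0 ≤ E := by positivity
    set Y : ℝ := s ^ n / s ^ q.length with hY
    have hY0 : 0 < Y := by positivity
    have hlen : (((u, u) :: L).length) + n ≤ K := by simp; omega
    have key : ∀ x ∈ nbr u, walkSum nbr base n ((u, x) :: L) x ≤
        Y / s * (c' * ballot n (q.length + 1) + E / s ^ 2) +
        (if x ∈ visited r L then Y / s * (3 * c * T ^ n) else 0) +
        (if s(u, x) ∈ oddEdges L then Y * s * (c' * ballot n (q.length - 1) + E / s ^ 2)
          else 0) := by
      intro x hx
      have p1 : 0 ≤ Y / s * (c' * ballot n (q.length + 1) + E / s ^ 2) := by positivity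
      have p2 : 0 ≤ (if x ∈ visited r L then Y / s * (3 * c * T ^ n) else 0) := by
        split_ifs <;> positivity
      by_cases he : s(u, x) ∈ oddEdges L
      · rw [if_pos he]
        obtain ⟨q', rfl⟩ := exists_eq_cons_of_mem_pathEdges hq.nodup (hq.oddEdges_eq ▸ he)
        have h1 := ih ((u, x) :: L) x q' (hw.cons hx) (hq.pop hl hw hx) hlen
        have h2 : s ^ n / s ^ q'.length = Y * s := by
          rw [hY, List.length_cons, pow_succ s q'.length]; field_simp
        rw [h2] at h1
        simp only [List.length_cons, Nat.add_sub_cancel] at h1 p1 ⊢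
        linarith
      · rw [if_neg he]
        -- At a visited vertex the path structure is lost and the crude supersolution takes over. At
        -- most K vertices do this instead of s², which gives the factor 1/s².
        by_cases hv : x ∈ visited r L
        · rw [if_pos hv]
          have h1 := walkSum_le hl hs0 hcard r K hc hbase n ((u, x) :: L) x (hw.cons hx) hlen
          have h2 := hw.excessWeight_insert_le hl hx he
          rw [hq.excessWeight_eq, hq.excess_eq, Nat.cast_zero] at h2
          rw [oddEdges_cons_of_notMem he, Finset.card_insert_of_notMem he, hq.card_oddEdges] at h1
          have h3 : 2 + 6 * K / s ^ 2 ≤ T := by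
            rw [hT]
            have : 6 * (K : ℝ) / s ^ 2 ≤ 6 * K := div_le_self (by positivity) (one_le_pow₀ hs)
            linarith
          have h4 : (2 + 6 * K / s ^ 2) ^ n ≤ T ^ n := pow_le_pow_left₀ (by positivity) h3 n
          have h5 : c * (2 + 6 * K / s ^ 2) ^ n * s ^ n / s ^ (q.length + 1) ≤
              c * T ^ n * s ^ n / s ^ (q.length + 1) := by gcongr
          have h6 := mul_le_mul h5 h2 (excessWeight_pos _ _).le (by positivity)
          have h7 : c * T ^ n * s ^ n / s ^ (q.length + 1) * (3 * (0 + 1) * 1) =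
              Y / s * (3 * c * T ^ n) := by rw [hY, pow_succ]; field_simp; ring
          linarith
        · rw [if_neg hv]
          have h1 := ih ((u, x) :: L) x (u :: q) (hw.cons hx) (hq.push hl hw hx hv) hlen
          have h2 : s ^ n / s ^ (u :: q).length = Y / s := by
            rw [hY, List.length_cons, pow_succ s q.length]; field_simp
          rw [h2] at h1
          simp only [List.length_cons] at h1
          linarith
    refine (Finset.sum_le_sum key).trans ?_
    rw [Finset.sum_add_distrib, Finset.sum_add_distrib, Finset.sum_const, nsmul_eq_mul]
    have e1 : ((nbr u).card : ℝ) * (Y / s * (c' * ballot n (q.length + 1) + E / s ^ 2)) ≤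
        Y * s * (c' * ballot n (q.length + 1) + E / s ^ 2) := by
      have := mul_le_mul_of_nonneg_right (hcard u)
        (by positivity : 0 ≤ Y / s * (c' * ballot n (q.length + 1) + E / s ^ 2))
      refine this.trans_eq ?_
      field_simp
    have e2 : ∑ x ∈ nbr u, (if x ∈ visited r L then Y / s * (3 * c * T ^ n) else (0 : ℝ)) ≤
        Y * s * (3 * K * c * T ^ n / s ^ 2) := by
      rw [← Finset.sum_filter, Finset.sum_const, nsmul_eq_mul]
      have h1 : (((nbr u).filter (· ∈ visited r L)).card : ℝ) ≤ K := by
        have h2 : ((nbr u).filter (· ∈ visited r L)).card ≤ (visited r L).card :=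
          Finset.card_le_card fun x hx => (Finset.mem_filter.1 hx).2
        have h3 := card_visited_le r L
        exact_mod_cast (by omega : ((nbr u).filter (· ∈ visited r L)).card ≤ K)
      refine (mul_le_mul_of_nonneg_right h1 (by positivity)).trans_eq ?_
      field_simp
    -- The difference of ballot numbers is the pop term: `ballot n (q.length - 1)` for a nonempty
    -- stack, and 0 for an empty one, where no closing move exists.
    have e3 : ∑ x ∈ nbr u, (if s(u, x) ∈ oddEdges L then
        Y * s * (c' * ballot n (q.length - 1) + E / s ^ 2) else (0 : ℝ)) ≤
        Y * s * (c' * (ballot (n + 1) q.length - ballot n (q.length + 1)) + E / s ^ 2) := by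
      rw [← Finset.sum_filter, Finset.sum_const, nsmul_eq_mul]
      cases q with
      | nil =>
        rw [Finset.filter_false_of_mem]
        · simp only [List.length_nil, Finset.card_empty, Nat.cast_zero, zero_mul, ballot]
          simp only [zero_add, sub_self, mul_zero]
          positivity
        · intro x _ he
          obtain ⟨q', hq'⟩ := exists_eq_cons_of_mem_pathEdges hq.nodup (hq.oddEdges_eq ▸ he)
          exact absurd hq' (by simp)
      | cons y q =>
        have h1 : (((nbr u).filter (fun x => s(u, x) ∈ oddEdges L)).card : ℝ) ≤ 1 := by
          have := hw.card_closing_le hl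
          rw [hq.excess_eq] at this
          exact_mod_cast this
        refine (mul_le_mul_of_nonneg_right h1 (by positivity)).trans_eq ?_
        simp only [List.length_cons, Nat.add_sub_cancel, ballot]
        push_cast
        ring
    refine (add_le_add (add_le_add e1 e2) e3).trans ?_
    have e4 : s ^ (n + 1) / s ^ q.length = Y * s := by rw [hY, pow_succ]; ring
    rw [e4]
    have hYs : 0 ≤ Y * s := by positivity
    have e5 : 2 * E + 3 * K * c * T ^ n ≤ (κ + (n + 1 : ℕ) * (3 * K * c)) * T ^ (n + 1) := by
      rw [hE, pow_succ]
      have hz : 0 ≤ T ^ n := by positivity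
      have hz2 : 0 ≤ (κ + n * (3 * K * c)) * T ^ n := by positivity
      have hz3 : 0 ≤ 3 * K * c * T ^ n := by positivity
      push_cast
      nlinarith
    have e6 : (2 * E + 3 * K * c * T ^ n) / s ^ 2 ≤
        (κ + (n + 1 : ℕ) * (3 * K * c)) * T ^ (n + 1) / s ^ 2 := by gcongr
    have e7 := mul_le_mul_of_nonneg_left e6 hYs
    have e8 : (2 * E + 3 * K * c * T ^ n) / s ^ 2 =
      E / s ^ 2 + 3 * K * c * T ^ n / s ^ 2 + E / s ^ 2 := by ring
    rw [e8] at e7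
    linarith

/-- The prefix L' holds the later steps, as lists start with the last step; it must be arbitrary for
the induction. -/
theorem walkSum_append_cancel {nbr : V → Finset V} {base : List (V × V) → V → ℝ}
    (hcancel : ∀ u x L L' v, x ∈ nbr u → base (L' ++ (x, u) :: (u, x) :: L) v = base (L' ++ L) v)
    {u x : V} (hx : x ∈ nbr u) (n : ℕ) (L L' : List (V × V)) (v : V) :
    walkSum nbr base n (L' ++ (x, u) :: (u, x) :: L) v = walkSum nbr base n (L' ++ L) v := by
  induction n generalizing L' v with
  | zero => exact hcancel u x L L' v hx
  | succ n ih =>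
    simp only [walkSum]
    exact Finset.sum_congr rfl fun y _ => ih ((v, y) :: L') y

/-- A lower bound for sums over walks in terms of the walks that are trivial on the tree. -/
theorem le_walkSum {nbr : V → Finset V} {s : ℝ} (hs : 0 < s)
    (hcard : ∀ u, s ^ 2 + 1 ≤ (nbr u).card) (hsymm : ∀ u v, v ∈ nbr u → u ∈ nbr v) (r : V)
    {base : List (V × V) → V → ℝ} (hbase : ∀ L u, 0 ≤ base L u) (hroot : 1 ≤ base [] r)
    (hcancel : ∀ u x L L' v, x ∈ nbr u → base (L' ++ (x, u) :: (u, x) :: L) v = base (L' ++ L) v)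
    (n : ℕ) (L : List (V × V)) (u : V) (hw : IsWalk nbr r L u) :
    s ^ n / s ^ L.length * ballot n L.length ≤ walkSum nbr base n L u := by
  induction n generalizing L u with
  | zero =>
    cases L with
    | nil =>
      have hu : u = r := hw
      simpa [walkSum, ballot, hu] using hroot
    | cons p L => simpa [walkSum, ballot] using hbase (p :: L) u
  | succ n ih =>
    rw [walkSum]
    cases L with
    | nil =>
      have h1 := Finset.card_nsmul_le_sum (nbr u) (fun x => walkSum nbr base n [(u, x)] x)
        (s ^ n / s ^ 1 * ballot n 1) fun x hx => ih [(u, x)] x (hw.cons hx)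
      refine le_trans ?_ h1
      rw [nsmul_eq_mul]
      have h2 := mul_le_mul_of_nonneg_right (hcard u)
        (by positivity : 0 ≤ s ^ n / s ^ 1 * (ballot n 1 : ℝ))
      refine le_trans ?_ h2
      have h3 : 0 ≤ s ^ n / s ^ 1 * (ballot n 1 : ℝ) := by positivity
      have h4 : s ^ (n + 1) / s ^ 0 * (ballot n 1 : ℝ) =
          s ^ 2 * (s ^ n / s ^ 1 * (ballot n 1 : ℝ)) := by
        rw [pow_succ]; field_simp
      simp only [List.length_nil, ballot]
      linarith
    | cons p L =>
      obtain ⟨y, z⟩ := p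
      obtain ⟨h1, h2, h3⟩ := hw
      simp only at h1 h2 h3
      subst h1
      -- L plays the role of a reduced word: reversing its last step pops it by cancellation. The
      -- remaining neighbours, still at least s² thanks to the extra 1 in `hcard`, are pushes.
      have hy : y ∈ nbr z := hsymm _ _ h2
      rw [← Finset.add_sum_erase _ _ hy]
      have hpop : walkSum nbr base n ((z, y) :: (y, z) :: L) y = walkSum nbr base n L y :=
        walkSum_append_cancel hcancel h2 n L [] y
      rw [hpop]
      have h4 := ih L y h3
      have h5 := Finset.card_nsmul_le_sum ((nbr z).erase y)
        (fun x => walkSum nbr base n ((z, x) :: (y, z) :: L) x)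
        (s ^ n / s ^ (L.length + 2) * ballot n (L.length + 2)) fun x hx =>
          ih ((z, x) :: (y, z) :: L) x ⟨rfl, Finset.mem_of_mem_erase hx, rfl, h2, h3⟩
      have h6 : s ^ 2 ≤ ((nbr z).erase y).card := by
        rw [Finset.card_erase_of_mem hy, Nat.cast_sub (Finset.card_pos.2 ⟨y, hy⟩)]
        have := hcard z
        push_cast
        linarith
      rw [nsmul_eq_mul] at h5
      have h7 := mul_le_mul_of_nonneg_right h6
        (by positivity : 0 ≤ s ^ n / s ^ (L.length + 2) * (ballot n (L.length + 2) : ℝ))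
      have h8 : s ^ 2 * (s ^ n / s ^ (L.length + 2) * (ballot n (L.length + 2) : ℝ)) +
          s ^ n / s ^ L.length * ballot n L.length =
          s ^ (n + 1) / s ^ (L.length + 1) * ballot (n + 1) (L.length + 1) := by
        rw [ballot, pow_succ, pow_succ s (L.length + 1), pow_succ s L.length]
        push_cast
        field_simp
        ring
      simp only [List.length_cons]
      linarith

end Stacks

/-! ### Moments of the two entry laws -/

theorem iIndepFun_integral_prod_complex {Ω ι : Type*} [MeasurableSpace Ω] {P : Measure Ω}
    [Fintype ι] {X : ι → Ω → ℂ} (hX : iIndepFun X P) (hm : ∀ i, AEMeasurable (X i) P)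
    {f : ι → ℂ → ℂ} (hf : ∀ i, Continuous (f i)) :
    ∫ ω, ∏ i, f i (X i ω) ∂P = ∏ i, ∫ ω, f i (X i ω) ∂P :=
  hX.integral_fun_prod_comp hm fun i => (hf i).aestronglyMeasurable

section Laws

theorem randomSignLaw_moment (a b : ℕ) :
    ∫ z, z ^ a * (starRingEnd ℂ z) ^ b ∂randomSignLaw = (1 + (-1) ^ (a + b)) / 2 := by
  have hi : ∀ x : ℂ, Integrable (fun z : ℂ => z ^ a * (starRingEnd ℂ z) ^ b)
      ((2⁻¹ : ENNReal) • Measure.dirac x) := fun x =>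
    (integrable_dirac (by finiteness)).smul_measure (by simp)
  rw [randomSignLaw, integral_add_measure (hi _) (hi _), integral_smul_measure,
    integral_smul_measure, integral_dirac, integral_dirac]
  simp [pow_add]
  ring

theorem randomPhaseLaw_moment (a b : ℕ) :
    ∫ z, z ^ a * (starRingEnd ℂ z) ^ b ∂randomPhaseLaw = if a = b then 1 else 0 := by
  have hvol : (volume : Measure ℝ) (Set.Ioo 0 (2 * Real.pi)) ≠ 0 := by
    simp [Real.pi_pos]
  have hm : Measurable fun t : ℝ => Complex.exp (Complex.I * (t : ℂ)) := by fun_prop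
  rw [randomPhaseLaw, integral_map hm.aemeasurable (by fun_prop)]
  have hexp : ∀ t : ℝ, Complex.exp (Complex.I * t) ^ a *
      (starRingEnd ℂ (Complex.exp (Complex.I * t))) ^ b =
      Complex.exp (((a : ℂ) - b) * Complex.I * t) := by
    intro t
    rw [← Complex.exp_conj, ← Complex.exp_nat_mul, ← Complex.exp_nat_mul, ← Complex.exp_add]
    congr 1
    simp
    ring
  simp only [hexp]
  split_ifs with hab
  · have : IsProbabilityMeasure (cond (volume : Measure ℝ) (Set.Ioo 0 (2 * Real.pi))) :=
      cond_isProbabilityMeasure_of_finite hvol (by simp [ENNReal.mul_eq_top])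
    simp [hab]
  · have hne : ((a : ℂ) - b) * Complex.I ≠ 0 := by
      refine mul_ne_zero (sub_ne_zero.2 ?_) Complex.I_ne_zero
      exact_mod_cast hab
    rw [ProbabilityTheory.cond, integral_smul_measure, ← integral_Ioc_eq_integral_Ioo,
      ← intervalIntegral.integral_of_le (by positivity), integral_exp_mul_complex hne]
    have : Complex.exp (((a : ℂ) - b) * Complex.I * (2 * Real.pi : ℝ)) = 1 := by
      rw [Complex.exp_eq_one_iff]
      exact ⟨(a : ℤ) - b, by push_cast; ring⟩
    rw [this]
    simp

variable {ν : Measure ℂ}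

/-- With the vanishing of odd mixed moments and unit modulus, this is all that the argument uses
about the two laws. -/
theorem moment_eq_zero_or_one (hν : ν = randomSignLaw ∨ ν = randomPhaseLaw) (a b : ℕ) :
    ∫ z, z ^ a * (starRingEnd ℂ z) ^ b ∂ν = 0 ∨ ∫ z, z ^ a * (starRingEnd ℂ z) ^ b ∂ν = 1 := by
  rcases hν with rfl | rfl
  · rw [randomSignLaw_moment]
    rcases Nat.even_or_odd (a + b) with h | h <;> simp [h.neg_one_pow]
  · rw [randomPhaseLaw_moment]
    split_ifs <;> simp

theorem moment_eq_zero_of_odd (hν : ν = randomSignLaw ∨ ν = randomPhaseLaw) {a b : ℕ}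
    (h : Odd (a + b)) : ∫ z, z ^ a * (starRingEnd ℂ z) ^ b ∂ν = 0 := by
  rcases hν with rfl | rfl
  · rw [randomSignLaw_moment, h.neg_one_pow]; simp
  · rw [randomPhaseLaw_moment, if_neg]
    rintro rfl
    exact (Nat.not_odd_iff_even.2 ⟨a, rfl⟩) h

theorem ae_norm_eq_one (hν : ν = randomSignLaw ∨ ν = randomPhaseLaw) : ∀ᵐ z ∂ν, ‖z‖ = 1 := by
  have hms : MeasurableSet {z : ℂ | ‖z‖ = 1} := (isClosed_eq continuous_norm continuous_const).measurableSet
  rcases hν with rfl | rfl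
  · rw [randomSignLaw, ae_add_measure_iff]
    constructor <;> refine Measure.ae_smul_measure ?_ _ <;> rw [ae_dirac_iff hms] <;> simp
  · rw [randomPhaseLaw, ae_map_iff (by fun_prop) hms]
    refine ae_of_all _ fun t => ?_
    rw [mul_comm, Complex.norm_exp_ofReal_mul_I]

end Laws

/-! ### Odd edges in terms of step counts -/

section Parity

variable {V : Type*} [DecidableEq V]

/-- The number of occurrences of a step in a list of steps. -/
def stepCount (p : V × V) (L : List (V × V)) : ℕ := L.count p

theorem stepCount_nil (p : V × V) : stepCount p [] = 0 := rfl

theorem stepCount_cons (p q : V × V) (L : List (V × V)) :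
    stepCount p (q :: L) = stepCount p L + if q = p then 1 else 0 := by
  simp [stepCount, List.count_cons]

theorem stepCount_eq_zero {p : V × V} {L : List (V × V)} (h : p ∉ L) : stepCount p L = 0 :=
  List.count_eq_zero_of_not_mem h

theorem mem_of_stepCount_pos {p : V × V} {L : List (V × V)} (h : 0 < stepCount p L) : p ∈ L :=
  List.count_pos_iff.1 h

theorem mem_oddEdges_iff {a b : V} (hab : a ≠ b) (L : List (V × V)) :
    s(a, b) ∈ oddEdges L ↔ Odd (stepCount (a, b) L + stepCount (b, a) L) := by
  induction L with
  | nil => simp [oddEdges, stepCount_nil]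
  | cons p L ih =>
    obtain ⟨c, d⟩ := p
    simp only [oddEdges, Finset.mem_symmDiff, Finset.mem_singleton, ih, stepCount_cons,
      Prod.mk.injEq, Sym2.eq_iff]
    by_cases h1 : c = a ∧ d = b
    · obtain ⟨rfl, rfl⟩ := h1
      simp [hab]
      grind
    · by_cases h2 : c = b ∧ d = a
      · obtain ⟨rfl, rfl⟩ := h2
        simp [hab]
        grind
      · have h3 : ¬ ((a = c ∧ b = d) ∨ (a = d ∧ b = c)) := by
          rintro (⟨rfl, rfl⟩ | ⟨rfl, rfl⟩) <;> simp_all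
        simp only [h1, h2, h3, if_false, add_zero]
        tauto

end Parity

/-! ### Expectations of products of entries along walks -/

section BandMatrix

set_option linter.unusedSectionVars false

/-- The neighbours of `u` in the band graph. -/
noncomputable def bandNbr (N : ℕ) (W : ℝ) (u : Fin N) : Finset (Fin N) :=
  open Classical in Finset.univ.filter fun v => 0 < cyclicDist u v ∧ (cyclicDist u v : ℝ) ≤ W

theorem cyclicDist_comm {N : ℕ} (u v : Fin N) : cyclicDist u v = cyclicDist v u := by
  simp only [cyclicDist, abs_sub_comm]

theorem cyclicDist_self {N : ℕ} (u : Fin N) : cyclicDist u u = 0 := by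
  simp [cyclicDist]

theorem cyclicDist_pos {N : ℕ} {u v : Fin N} (h : u ≠ v) : 0 < cyclicDist u v := by
  have h1 : (u : ℤ) - v ≠ 0 := by
    rw [sub_ne_zero]
    exact_mod_cast Fin.val_injective.ne h
  have h2 := u.2
  have h3 := v.2
  rw [cyclicDist, lt_min_iff, abs_pos]
  refine ⟨h1, ?_⟩
  rw [sub_pos, abs_lt]
  omega

theorem mem_bandNbr {N : ℕ} {W : ℝ} {u v : Fin N} :
    v ∈ bandNbr N W u ↔ 0 < cyclicDist u v ∧ (cyclicDist u v : ℝ) ≤ W := by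
  simp [bandNbr]

theorem notMem_bandNbr_self {N : ℕ} {W : ℝ} (u : Fin N) : u ∉ bandNbr N W u := by
  simp [mem_bandNbr, cyclicDist_self]

theorem mem_bandNbr_comm {N : ℕ} {W : ℝ} {u v : Fin N} (h : v ∈ bandNbr N W u) :
    u ∈ bandNbr N W v := by
  rw [mem_bandNbr, cyclicDist_comm] at *
  rwa [cyclicDist_comm]

/-- The product of the entries of a matrix along a list of steps. -/
def stepProd {N : ℕ} (A : Matrix (Fin N) (Fin N) ℂ) (L : List (Fin N × Fin N)) : ℂ :=
  (L.map fun p => A p.1 p.2).prod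

theorem stepProd_cons {N : ℕ} (A : Matrix (Fin N) (Fin N) ℂ) (p : Fin N × Fin N)
    (L : List (Fin N × Fin N)) : stepProd A (p :: L) = A p.1 p.2 * stepProd A L := by
  simp [stepProd]

/-- Grouping the factors by entries above the diagonal, with conjugates for the reversed steps,
prepares for independence. -/
theorem stepProd_eq_prod {N : ℕ} {A : Matrix (Fin N) (Fin N) ℂ} (hA : A.IsHermitian)
    {L : List (Fin N × Fin N)} (hL : ∀ p ∈ L, p.1 ≠ p.2) :
    stepProd A L = ∏ p : {p : Fin N × Fin N // p.1 < p.2},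
      A p.1.1 p.1.2 ^ (stepCount (p.1.1, p.1.2) L) *
        (starRingEnd ℂ (A p.1.1 p.1.2)) ^ (stepCount (p.1.2, p.1.1) L) := by
  induction L with
  | nil => simp [stepProd, stepCount_nil]
  | cons s L ih =>
    obtain ⟨a, b⟩ := s
    have hab : a ≠ b := hL (a, b) (by simp)
    rw [stepProd_cons, ih fun p hp => hL p (List.mem_cons_of_mem _ hp)]
    have h1 : A a b = ∏ p : {p : Fin N × Fin N // p.1 < p.2},
        ((if (a, b) = (p.1.1, p.1.2) then A p.1.1 p.1.2 else 1) *
          (if (a, b) = (p.1.2, p.1.1) then starRingEnd ℂ (A p.1.1 p.1.2) else 1)) := by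
      rcases lt_or_gt_of_ne hab with h | h
      · rw [Finset.prod_eq_single (⟨(a, b), h⟩ : {p : Fin N × Fin N // p.1 < p.2})]
        · simp [hab]
        · rintro ⟨⟨c, d⟩, hcd⟩ _ hne
          simp only at hcd
          rw [if_neg, if_neg, mul_one]
          · simp only [Prod.mk.injEq]
            rintro ⟨rfl, rfl⟩
            exact lt_asymm h hcd
          · simp only [Prod.mk.injEq]
            rintro ⟨rfl, rfl⟩
            exact hne rfl
        · simp
      · rw [Finset.prod_eq_single (⟨(b, a), h⟩ : {p : Fin N × Fin N // p.1 < p.2})]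
        · simpa [hab] using (hA.apply a b).symm
        · rintro ⟨⟨c, d⟩, hcd⟩ _ hne
          simp only at hcd
          rw [if_neg, if_neg, mul_one]
          · simp only [Prod.mk.injEq]
            rintro ⟨rfl, rfl⟩
            exact hne rfl
          · simp only [Prod.mk.injEq]
            rintro ⟨rfl, rfl⟩
            exact lt_asymm h hcd
        · simp
    rw [h1, ← Finset.prod_mul_distrib]
    refine Finset.prod_congr rfl fun p _ => ?_
    simp only [stepCount_cons, pow_add]
    split_ifs <;> ring

namespace IsRandomBandMatrix

variable {Ω : Type*} [MeasurableSpace Ω] {P : Measure Ω} {ν : Measure ℂ} {N : ℕ} {W : ℝ}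
  {H : Ω → Matrix (Fin N) (Fin N) ℂ}

theorem eq_zero_of_notMem (hH : IsRandomBandMatrix P ν N W H) {u v : Fin N}
    (h : v ∉ bandNbr N W u) (ω : Ω) : H ω u v = 0 := by
  refine hH.eq_zero ω u v ?_
  by_contra! h'
  exact h (mem_bandNbr.2 ⟨cyclicDist_pos h'.2, h'.1⟩)

theorem map_eq (hH : IsRandomBandMatrix P ν N W H) {u v : Fin N} (h : v ∈ bandNbr N W u) :
    P.map (fun ω => H ω u v) = ν :=
  hH.law u v (mem_bandNbr.1 h).1 (mem_bandNbr.1 h).2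

theorem ae_norm_entry (hH : IsRandomBandMatrix P ν N W H)
    (hν : ν = randomSignLaw ∨ ν = randomPhaseLaw) {u v : Fin N} (h : v ∈ bandNbr N W u) :
    ∀ᵐ ω ∂P, ‖H ω u v‖ = 1 := by
  have h1 := ae_norm_eq_one hν
  rw [← hH.map_eq h] at h1
  exact ae_of_ae_map (hH.measurable_entry u v).aemeasurable h1

theorem measurable_stepProd (hH : IsRandomBandMatrix P ν N W H) (L : List (Fin N × Fin N)) :
    Measurable fun ω => stepProd (H ω) L := by
  induction L with
  | nil => simp [stepProd]
  | cons p L ih =>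
    simp only [stepProd_cons]
    exact (hH.measurable_entry _ _).mul ih

theorem ae_norm_stepProd_le (hH : IsRandomBandMatrix P ν N W H)
    (hν : ν = randomSignLaw ∨ ν = randomPhaseLaw) (L : List (Fin N × Fin N)) :
    ∀ᵐ ω ∂P, ‖stepProd (H ω) L‖ ≤ 1 := by
  induction L with
  | nil => simp [stepProd]
  | cons p L ih =>
    by_cases h : p.2 ∈ bandNbr N W p.1
    · filter_upwards [ih, hH.ae_norm_entry hν h] with ω h1 h2
      rw [stepProd_cons, norm_mul, h2, one_mul]
      exact h1
    · refine ae_of_all _ fun ω => ?_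
      rw [stepProd_cons, hH.eq_zero_of_notMem h]
      simp

variable [IsProbabilityMeasure P]

theorem integrable_stepProd (hH : IsRandomBandMatrix P ν N W H)
    (hν : ν = randomSignLaw ∨ ν = randomPhaseLaw) (L : List (Fin N × Fin N)) :
    Integrable (fun ω => stepProd (H ω) L) P :=
  Integrable.of_bound (hH.measurable_stepProd L).aestronglyMeasurable 1
    (hH.ae_norm_stepProd_le hν L)

theorem integral_stepProd (hH : IsRandomBandMatrix P ν N W H) {L : List (Fin N × Fin N)}
    (hL : ∀ p ∈ L, p.2 ∈ bandNbr N W p.1) :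
    ∫ ω, stepProd (H ω) L ∂P = ∏ p : {p : Fin N × Fin N // p.1 < p.2},
      if p.1.2 ∈ bandNbr N W p.1.1 then
        ∫ z, z ^ (stepCount (p.1.1, p.1.2) L) * (starRingEnd ℂ z) ^ (stepCount (p.1.2, p.1.1) L) ∂ν
      else 1 := by
  have hL' : ∀ p ∈ L, p.1 ≠ p.2 := fun p hp h =>
    notMem_bandNbr_self (W := W) p.1 (by simpa [← h] using hL p hp)
  simp only [fun ω => stepProd_eq_prod (hH.isHermitian ω) hL']
  have h1 := iIndepFun_integral_prod_complex hH.indep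
      (f := fun p z => z ^ stepCount (p.1.1, p.1.2) L *
        (starRingEnd ℂ z) ^ stepCount (p.1.2, p.1.1) L)
      (fun p => (hH.measurable_entry _ _).aemeasurable) (fun p => by fun_prop)
  rw [h1]
  refine Finset.prod_congr rfl fun p _ => ?_
  obtain ⟨⟨a, b⟩, hab⟩ := p
  simp only
  split_ifs with h
  · rw [← hH.map_eq h]
    have h2 : AEStronglyMeasurable (fun z : ℂ => z ^ stepCount (a, b) L *
        (starRingEnd ℂ z) ^ stepCount (b, a) L) (P.map fun ω => H ω a b) := by
      refine Continuous.aestronglyMeasurable ?_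
      fun_prop
    exact (integral_map (hH.measurable_entry a b).aemeasurable h2).symm
  · have h2 : (a, b) ∉ L := fun hm => h (hL (a, b) hm)
    have h3 : (b, a) ∉ L := fun hm => h (mem_bandNbr_comm (u := b) (hL (b, a) hm))
    rw [stepCount_eq_zero h2, stepCount_eq_zero h3]
    simp

theorem integral_stepProd_eq_zero_or_one (hH : IsRandomBandMatrix P ν N W H)
    (hν : ν = randomSignLaw ∨ ν = randomPhaseLaw) (L : List (Fin N × Fin N)) :
    ∫ ω, stepProd (H ω) L ∂P = 0 ∨ ∫ ω, stepProd (H ω) L ∂P = 1 := by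
  by_cases hL : ∀ p ∈ L, p.2 ∈ bandNbr N W p.1
  · rw [hH.integral_stepProd hL]
    refine Finset.prod_induction _ (fun z : ℂ => z = 0 ∨ z = 1) ?_ (Or.inr rfl) fun p _ => ?_
    · rintro a b (rfl | rfl) (rfl | rfl) <;> simp
    · split_ifs
      · exact moment_eq_zero_or_one hν _ _
      · exact Or.inr rfl
  · push Not at hL
    obtain ⟨p, hp, h⟩ := hL
    left
    have : ∀ ω, stepProd (H ω) L = 0 := fun ω =>
      List.prod_eq_zero (List.mem_map.2 ⟨p, hp, hH.eq_zero_of_notMem h ω⟩)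
    simp [this]

theorem integral_stepProd_eq_zero (hH : IsRandomBandMatrix P ν N W H)
    (hν : ν = randomSignLaw ∨ ν = randomPhaseLaw) {L : List (Fin N × Fin N)}
    (hodd : (oddEdges L).Nonempty) : ∫ ω, stepProd (H ω) L ∂P = 0 := by
  by_cases hL : ∀ p ∈ L, p.2 ∈ bandNbr N W p.1
  · obtain ⟨e, he⟩ := hodd
    have key : ∀ a b : Fin N, a < b → s(a, b) ∈ oddEdges L → ∫ ω, stepProd (H ω) L ∂P = 0 := by
      intro a b hab hm
      rw [mem_oddEdges_iff hab.ne] at hm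
      rw [hH.integral_stepProd hL]
      refine Finset.prod_eq_zero (Finset.mem_univ ⟨(a, b), hab⟩) ?_
      have hb : b ∈ bandNbr N W a := by
        have : 0 < stepCount (a, b) L + stepCount (b, a) L := hm.pos
        rcases Nat.eq_zero_or_pos (stepCount (a, b) L) with h0 | h0
        · have h1 : (b, a) ∈ L := mem_of_stepCount_pos (by omega)
          exact mem_bandNbr_comm (u := b) (hL (b, a) h1)
        · exact hL (a, b) (mem_of_stepCount_pos h0)
      simp only [hb, if_true]
      exact moment_eq_zero_of_odd hν hm
    induction e with
    | _ a b =>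
      rcases lt_trichotomy a b with h | h | h
      · exact key a b h he
      · subst h
        exfalso
        -- A diagonal odd edge would need a step from a vertex to itself, which is not in the band.
        clear key
        induction L with
        | nil => simp [oddEdges] at he
        | cons p L ih =>
          simp only [oddEdges, Finset.mem_symmDiff, Finset.mem_singleton] at he
          rcases he with he | he
          · exact ih (fun q hq => hL q (List.mem_cons_of_mem _ hq)) he.1
          · have h1 := hL p (by simp)
            have h2 := Sym2.eq_iff.1 he.1
            have h3 : p.1 = p.2 := by
              rcases h2 with ⟨h4, h5⟩ | ⟨h4, h5⟩ <;> rw [← h4, ← h5]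
            rw [h3] at h1
            exact notMem_bandNbr_self _ h1
      · exact key b a h (Sym2.eq_swap ▸ he)
  · push Not at hL
    obtain ⟨p, hp, h⟩ := hL
    have : ∀ ω, stepProd (H ω) L = 0 := fun ω =>
      List.prod_eq_zero (List.mem_map.2 ⟨p, hp, hH.eq_zero_of_notMem h ω⟩)
    simp [this]

/-- Almost surely H_xu H_ux = |H_ux|² = 1: unimodularity makes backtracking cancel exactly. -/
theorem integral_stepProd_cancel (hH : IsRandomBandMatrix P ν N W H)
    (hν : ν = randomSignLaw ∨ ν = randomPhaseLaw) {u x : Fin N} (hx : x ∈ bandNbr N W u)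
    (L L' : List (Fin N × Fin N)) :
    ∫ ω, stepProd (H ω) (L' ++ (x, u) :: (u, x) :: L) ∂P = ∫ ω, stepProd (H ω) (L' ++ L) ∂P := by
  refine integral_congr_ae ?_
  filter_upwards [hH.ae_norm_entry hν hx] with ω hω
  simp only [stepProd, List.map_append, List.map_cons, List.prod_append, List.prod_cons]
  have h1 : H ω x u * H ω u x = 1 := by
    rw [← (hH.isHermitian ω).apply x u, RCLike.star_def, Complex.conj_mul', hω]
    simp
  rw [← mul_assoc (H ω x u), h1, one_mul]

end IsRandomBandMatrix

end BandMatrix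

/-! ### Degrees in the band graph -/

section Degrees

/-- The cyclic residues at distance at most `w` from zero, zero excluded. -/
def bandResidues (N w : ℕ) : Finset ℕ := Finset.Icc 1 w ∪ Finset.Ico (N - w) N

/-- Translation by -u reduces to the neighbours of 0. -/
theorem card_bandNbr {N : ℕ} {W : ℝ} (hW : 0 ≤ W) (hWN : 2 * W ≤ N) (u : Fin N) :
    (bandNbr N W u).card = (bandResidues N ⌊W⌋₊).card := by
  have hN : 0 < N := u.pos
  have : NeZero N := ⟨hN.ne'⟩
  set w := ⌊W⌋₊ with hw
  have h2w : 2 * w ≤ N := by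
    have h1 : (w : ℝ) ≤ W := Nat.floor_le hW
    exact_mod_cast (by linarith : 2 * (w : ℝ) ≤ N)
  have hmem : ∀ v : Fin N, v ∈ bandNbr N W u ↔ ((v - u : Fin N) : ℕ) ∈ bandResidues N w := by
    intro v
    have hu := u.2
    have hv := v.2
    have hle : (cyclicDist u v : ℝ) ≤ W ↔ cyclicDist u v ≤ w := by
      rw [hw, Int.natCast_floor_eq_floor hW, Int.le_floor]
    rw [mem_bandNbr, hle, Fin.val_sub]
    simp only [bandResidues, Finset.mem_union, Finset.mem_Icc, Finset.mem_Ico, cyclicDist]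
    rcases le_or_gt (u : ℕ) v with h | h
    · have e1 : (N - (u : ℕ) + v) % N = v - u := by
        rw [show N - (u : ℕ) + v = (v - u) + N by omega, Nat.add_mod_right,
          Nat.mod_eq_of_lt (by omega)]
      rw [e1, abs_of_nonpos (by omega)]
      omega
    · have e1 : (N - (u : ℕ) + v) % N = N - u + v := Nat.mod_eq_of_lt (by omega)
      rw [e1, abs_of_pos (by omega)]
      omega
  refine Finset.card_bij (fun v _ => ((v - u : Fin N) : ℕ)) (fun v hv => (hmem v).1 hv) ?_ ?_
  · intro a _ b _ hab
    exact sub_left_injective (Fin.val_injective hab)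
  · intro b hb
    have hbN : b < N := by
      simp only [bandResidues, Finset.mem_union, Finset.mem_Icc, Finset.mem_Ico] at hb
      omega
    have e : ((⟨b, hbN⟩ + u - u : Fin N) : ℕ) = b := by rw [add_sub_cancel_right]
    exact ⟨⟨b, hbN⟩ + u, (hmem _).2 (by rwa [e]), e⟩

theorem card_bandNbr_le {N : ℕ} {W : ℝ} (hW : 0 ≤ W) (hWN : 2 * W ≤ N) (u : Fin N) :
    ((bandNbr N W u).card : ℝ) ≤ 2 * W := by
  rw [card_bandNbr hW hWN u]
  have h1 : (bandResidues N ⌊W⌋₊).card ≤ ⌊W⌋₊ + ⌊W⌋₊ := by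
    refine (Finset.card_union_le _ _).trans ?_
    simp only [Nat.card_Icc, Nat.card_Ico]
    omega
  have h2 : ((bandResidues N ⌊W⌋₊).card : ℝ) ≤ ⌊W⌋₊ + ⌊W⌋₊ := by exact_mod_cast h1
  have := Nat.floor_le hW
  linarith

/-- The floor costs at most 2; the antipodal residue, common to both arcs when 2⌊W⌋ = N, costs 1. -/
theorem le_card_bandNbr {N : ℕ} {W : ℝ} (hW : 0 ≤ W) (hWN : 2 * W ≤ N) (u : Fin N) :
    2 * W - 3 ≤ (bandNbr N W u).card := by
  rw [card_bandNbr hW hWN u]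
  have hN := u.pos
  have h0 := Nat.floor_le hW
  have h2w : 2 * ⌊W⌋₊ ≤ N := by exact_mod_cast (by linarith : 2 * (⌊W⌋₊ : ℝ) ≤ N)
  have h1 : 2 * ⌊W⌋₊ ≤ (bandResidues N ⌊W⌋₊).card + 1 := by
    have h3 : Finset.Icc 1 ⌊W⌋₊ ∪ Finset.Ico (N - ⌊W⌋₊ + 1) N ⊆ bandResidues N ⌊W⌋₊ := by
      refine Finset.union_subset_union_right (Finset.Ico_subset_Ico_left (by omega))
    have h4 := Finset.card_le_card h3
    rw [Finset.card_union_of_disjoint, Nat.card_Icc, Nat.card_Ico] at h4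
    · omega
    · rw [Finset.disjoint_left]
      intro a ha hb
      simp only [Finset.mem_Icc, Finset.mem_Ico] at ha hb
      omega
  have h2 : 2 * (⌊W⌋₊ : ℝ) ≤ (bandResidues N ⌊W⌋₊).card + 1 := by exact_mod_cast h1
  have := Nat.lt_floor_add_one W
  linarith

end Degrees

/-! ### Moments of diagonal entries as walk sums -/

namespace IsRandomBandMatrix

variable {Ω : Type*} [MeasurableSpace Ω] {P : Measure Ω} {ν : Measure ℂ} {N : ℕ} {W : ℝ}
  {H : Ω → Matrix (Fin N) (Fin N) ℂ}

theorem pow_succ_mulVec (hH : IsRandomBandMatrix P ν N W H) (n : ℕ) (x : Fin N → ℂ) (u : Fin N)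
    (ω : Ω) : ((H ω ^ (n + 1)).mulVec x) u =
      ∑ y ∈ bandNbr N W u, H ω u y * ((H ω ^ n).mulVec x) y := by
  rw [pow_succ', ← Matrix.mulVec_mulVec, Matrix.mulVec, dotProduct]
  symm
  refine Finset.sum_subset (Finset.subset_univ _) fun y _ hy => ?_
  rw [hH.eq_zero_of_notMem hy, zero_mul]

/-- The expectations of the entries of `H ^ n` applied to a random vector satisfy the walk
recursion. -/
theorem integral_stepProd_mul_pow (hH : IsRandomBandMatrix P ν N W H) {X : Ω → Fin N → ℂ}
    (hX : ∀ L u, Integrable (fun ω => stepProd (H ω) L * X ω u) P) (n : ℕ)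
    (L : List (Fin N × Fin N)) (u : Fin N) :
    Integrable (fun ω => stepProd (H ω) L * ((H ω ^ n).mulVec (X ω)) u) P ∧
    (∫ ω, stepProd (H ω) L * ((H ω ^ n).mulVec (X ω)) u ∂P).re =
      walkSum (bandNbr N W) (fun L u => (∫ ω, stepProd (H ω) L * X ω u ∂P).re) n L u := by
  induction n generalizing L u with
  | zero => simpa [walkSum] using hX L u
  | succ n ih =>
    have h1 : ∀ ω, stepProd (H ω) L * ((H ω ^ (n + 1)).mulVec (X ω)) u =
        ∑ y ∈ bandNbr N W u, stepProd (H ω) ((u, y) :: L) * ((H ω ^ n).mulVec (X ω)) y := by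
      intro ω
      rw [hH.pow_succ_mulVec, Finset.mul_sum]
      refine Finset.sum_congr rfl fun y _ => ?_
      rw [stepProd_cons]
      ring
    simp only [h1]
    refine ⟨integrable_finsetSum _ fun y _ => (ih _ y).1, ?_⟩
    rw [integral_finsetSum _ fun y _ => (ih _ y).1, Complex.re_sum, walkSum]
    exact Finset.sum_congr rfl fun y _ => (ih _ y).2

/-- The base of the walk recursion for the diagonal entries of the powers of `H`. -/
noncomputable def momentBase (P : Measure Ω) (H : Ω → Matrix (Fin N) (Fin N) ℂ) (r : Fin N)
    (L : List (Fin N × Fin N)) (u : Fin N) : ℝ :=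
  if u = r then (∫ ω, stepProd (H ω) L ∂P).re else 0

variable [IsProbabilityMeasure P]

theorem integral_stepProd_mul_pow_apply (hH : IsRandomBandMatrix P ν N W H)
    (hν : ν = randomSignLaw ∨ ν = randomPhaseLaw) (r : Fin N) (n : ℕ)
    (L : List (Fin N × Fin N)) (u : Fin N) :
    Integrable (fun ω => stepProd (H ω) L * (H ω ^ n) u r) P ∧
    (∫ ω, stepProd (H ω) L * (H ω ^ n) u r ∂P).re =
      walkSum (bandNbr N W) (momentBase P H r) n L u := by
  have h1 := hH.integral_stepProd_mul_pow (X := fun _ => Pi.single r 1) ?_ n L u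
  · have h2 : (fun L u => (∫ ω, stepProd (H ω) L * (Pi.single r 1 : Fin N → ℂ) u ∂P).re) =
        momentBase P H r := by
      funext L u
      simp only [momentBase, Pi.single_apply]
      split_ifs <;> simp
    rw [h2] at h1
    simpa using h1
  · intro L u
    simp only [Pi.single_apply]
    split_ifs
    · simpa using hH.integrable_stepProd hν L
    · simp

/-- The recursion for random vectors applies to (H^m)_rr e_r: the walk returns to r after n steps
and then continues for m more, so two walk sums are nested. -/
theorem integral_pow_apply_mul_pow_apply (hH : IsRandomBandMatrix P ν N W H)
    (hν : ν = randomSignLaw ∨ ν = randomPhaseLaw) (r : Fin N) (m n : ℕ) :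
    Integrable (fun ω => (H ω ^ n) r r * (H ω ^ m) r r) P ∧
    (∫ ω, (H ω ^ n) r r * (H ω ^ m) r r ∂P).re =
      walkSum (bandNbr N W) (fun L u => if u = r then
        walkSum (bandNbr N W) (momentBase P H r) m L r else 0) n [] r := by
  have h1 := hH.integral_stepProd_mul_pow
    (X := fun ω => Pi.single r ((H ω ^ m) r r)) ?_ n [] r
  · have h2 : (fun L u => (∫ ω, stepProd (H ω) L *
        (Pi.single r ((H ω ^ m) r r) : Fin N → ℂ) u ∂P).re) =
        fun L u => if u = r then walkSum (bandNbr N W) (momentBase P H r) m L r else 0 := by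
      funext L u
      simp only [Pi.single_apply]
      split_ifs
      · exact (hH.integral_stepProd_mul_pow_apply hν r m L r).2
      · simp
    rw [h2] at h1
    simpa [stepProd, Matrix.mulVec_single, mul_comm] using h1
  · intro L u
    simp only [Pi.single_apply]
    split_ifs
    · exact (hH.integral_stepProd_mul_pow_apply hν r m L r).1
    · simp

theorem momentBase_nonneg (hH : IsRandomBandMatrix P ν N W H)
    (hν : ν = randomSignLaw ∨ ν = randomPhaseLaw) (r : Fin N) (L : List (Fin N × Fin N))
    (u : Fin N) : 0 ≤ momentBase P H r L u := by
  unfold momentBase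
  split_ifs
  · rcases hH.integral_stepProd_eq_zero_or_one hν L with h | h <;> simp [h]
  · exact le_rfl

theorem momentBase_le_one (hH : IsRandomBandMatrix P ν N W H)
    (hν : ν = randomSignLaw ∨ ν = randomPhaseLaw) (r : Fin N) (L : List (Fin N × Fin N))
    (u : Fin N) : momentBase P H r L u ≤ 1 := by
  unfold momentBase
  split_ifs
  · rcases hH.integral_stepProd_eq_zero_or_one hν L with h | h <;> simp [h]
  · exact zero_le_one

theorem momentBase_le (hH : IsRandomBandMatrix P ν N W H)
    (hν : ν = randomSignLaw ∨ ν = randomPhaseLaw) {s : ℝ} (hs : 0 < s) (r : Fin N)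
    (L : List (Fin N × Fin N)) (u : Fin N) :
    momentBase P H r L u ≤ 1 / s ^ (oddEdges L).card * excessWeight r (oddEdges L) := by
  have hw := excessWeight_pos r (oddEdges L)
  rcases Finset.eq_empty_or_nonempty (oddEdges L) with h | h
  · refine (hH.momentBase_le_one hν r L u).trans ?_
    have := one_le_excessWeight r (oddEdges L)
    rw [h] at this ⊢
    simpa using this
  · have : momentBase P H r L u = 0 := by
      unfold momentBase
      rw [hH.integral_stepProd_eq_zero hν h]
      simp
    rw [this]
    positivity

/-- The upper bound for the moments, uniform in the exponent. -/
theorem re_integral_pow_apply_le (hH : IsRandomBandMatrix P ν N W H)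
    (hν : ν = randomSignLaw ∨ ν = randomPhaseLaw) {s : ℝ} (hs : 0 < s)
    (hcard : ∀ u, ((bandNbr N W u).card : ℝ) ≤ s ^ 2) (r : Fin N) (n : ℕ) :
    (∫ ω, (H ω ^ n) r r ∂P).re ≤ (2 + 6 * n / s ^ 2) ^ n * s ^ n := by
  have h1 := (hH.integral_stepProd_mul_pow_apply hν r n [] r).2
  simp only [stepProd, List.map_nil, List.prod_nil, one_mul] at h1
  have h2 := walkSum_le notMem_bandNbr_self hs hcard r n zero_le_one
    (fun L u _ _ => hH.momentBase_le hν hs r L u) n [] r rfl (by simp)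
  rw [h1]
  refine h2.trans_eq ?_
  rw [(IsStack.nil r).excessWeight_eq]
  simp [oddEdges]

/-- Only walks ending at r count, and there the stack is empty. -/
theorem momentBase_le_ballot (hH : IsRandomBandMatrix P ν N W H)
    (hν : ν = randomSignLaw ∨ ν = randomPhaseLaw) {s : ℝ} (hs : 0 < s) (r : Fin N)
    {L : List (Fin N × Fin N)} {u : Fin N} {q : List (Fin N)} (hq : IsStack r L u q) :
    momentBase P H r L u ≤ (1 * ballot 0 q.length + 0 / s ^ 2) / s ^ q.length := by
  by_cases hu : u = r
  · subst hu
    rw [hq.eq_nil]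
    simpa [ballot] using hH.momentBase_le_one hν u L u
  · rw [momentBase, if_neg hu]
    positivity

/-- The upper bound for the second moment of a diagonal entry of a power of `H`, sharp as the band
width grows. -/
theorem re_integral_pow_apply_sq_le (hH : IsRandomBandMatrix P ν N W H)
    (hν : ν = randomSignLaw ∨ ν = randomPhaseLaw) {s : ℝ} (hs : 1 ≤ s)
    (hcard : ∀ u, ((bandNbr N W u).card : ℝ) ≤ s ^ 2) (r : Fin N) (n : ℕ) :
    (∫ ω, (H ω ^ n) r r * (H ω ^ n) r r ∂P).re ≤ s ^ (2 * n) *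
      ((ballot n 0 : ℝ) ^ 2 + 12 * n ^ 2 * (2 + 12 * n) ^ (2 * n) / s ^ 2) := by
  have hs0 : 0 < s := by linarith
  set K : ℕ := 2 * n with hK
  set T : ℝ := 2 + 6 * K with hT
  have hT0 : 0 < T := by positivity
  rw [(hH.integral_pow_apply_mul_pow_apply hν r n n).2]
  have hcrude : ∀ (L : List (Fin N × Fin N)) (u : Fin N), IsWalk (bandNbr N W) r L u →
      L.length ≤ n → (if u = r then walkSum (bandNbr N W) (momentBase P H r) n L r else 0) ≤
        T ^ n * s ^ n / s ^ (oddEdges L).card * excessWeight r (oddEdges L) := by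
    intro L u hL hlen
    have hw := excessWeight_pos r (oddEdges L)
    split_ifs with hu
    · subst hu
      refine (walkSum_le notMem_bandNbr_self hs0 hcard u K zero_le_one
        (fun L u' _ _ => hH.momentBase_le hν hs0 u L u') n L u hL (by omega)).trans ?_
      rw [one_mul]
      have : 6 * (K : ℝ) / s ^ 2 ≤ 6 * K := div_le_self (by positivity) (one_le_pow₀ hs)
      have h3 : 2 + 6 * (K : ℝ) / s ^ 2 ≤ T := by linarith
      gcongr
    · positivity
  have hballot : ∀ (L : List (Fin N × Fin N)) (u : Fin N) (q : List (Fin N)),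
      IsWalk (bandNbr N W) r L u → L.length ≤ n → IsStack r L u q →
      (if u = r then walkSum (bandNbr N W) (momentBase P H r) n L r else 0) ≤
        (s ^ n * ballot n 0 * ballot 0 q.length +
          s ^ n * (n * (3 * K * 1) * T ^ n) / s ^ 2) / s ^ q.length := by
    intro L u q hL hlen hq
    split_ifs with hu
    · subst hu
      have h1 := walkSum_le_ballot notMem_bandNbr_self hs hcard u K zero_le_one zero_le_one le_rfl
        (fun L u' _ _ => hH.momentBase_le hν hs0 u L u')
        (fun L u' q _ _ hq => hH.momentBase_le_ballot hν hs0 u hq) n L u q hL hq (by omega)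
      rw [hq.eq_nil] at h1 ⊢
      refine h1.trans_eq ?_
      simp only [List.length_nil, ballot, pow_zero, hT]
      push_cast
      ring
    · positivity
  -- The inner sum is now the base. A tree-like walk that is back at r has an empty stack, so the
  -- main terms multiply to the square of the ballot number.
  have h2 := walkSum_le_ballot notMem_bandNbr_self hs hcard r n (by positivity) (by positivity)
    (by positivity) hcrude hballot n [] r [] rfl (IsStack.nil r) (by simp)
  refine h2.trans ?_
  simp only [List.length_nil, pow_zero, div_one]
  have hTn : (2 + 6 * (n : ℝ)) ^ n ≤ T ^ n := by
    rw [hT, hK]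
    push_cast
    gcongr
    linarith [(Nat.cast_nonneg n : (0 : ℝ) ≤ n)]
  have e2 : (12 * (n : ℝ) ^ 2 * (2 + 12 * n) ^ (2 * n)) = (12 * (n : ℝ) ^ 2) * (T ^ n * T ^ n) := by
    rw [hT, hK, ← pow_add, two_mul n]
    push_cast
    ring
  rw [e2]
  have hn2 : (0 : ℝ) ≤ n ^ 2 := by positivity
  calc s ^ n * (s ^ n * ballot n 0 * ballot n 0 +
        (s ^ n * (n * (3 * K * 1) * T ^ n) + n * (3 * n * (T ^ n * s ^ n))) *
          (2 + 6 * (n : ℝ)) ^ n / s ^ 2)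
      ≤ s ^ n * (s ^ n * ballot n 0 * ballot n 0 +
        (s ^ n * (n * (3 * K * 1) * T ^ n) + n * (3 * n * (T ^ n * s ^ n))) *
          T ^ n / s ^ 2) := by gcongr
    _ = s ^ (2 * n) * ((ballot n 0 : ℝ) ^ 2 + (9 * n ^ 2) * (T ^ n * T ^ n) / s ^ 2) := by
        rw [hK, pow_mul' s 2 n]
        push_cast
        ring
    _ ≤ _ := by
        gcongr
        norm_num

/-- The lower bound for the moments. -/
theorem le_re_integral_pow_apply (hH : IsRandomBandMatrix P ν N W H)
    (hν : ν = randomSignLaw ∨ ν = randomPhaseLaw) {s : ℝ} (hs : 0 < s)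
    (hcard : ∀ u, s ^ 2 + 1 ≤ (bandNbr N W u).card) (r : Fin N) (n : ℕ) :
    s ^ n * ballot n 0 ≤ (∫ ω, (H ω ^ n) r r ∂P).re := by
  have h1 := (hH.integral_stepProd_mul_pow_apply hν r n [] r).2
  simp only [stepProd, List.map_nil, List.prod_nil, one_mul] at h1
  rw [h1]
  have h2 := le_walkSum hs hcard (fun u v => mem_bandNbr_comm) r
    (hH.momentBase_nonneg hν r) (by simp [momentBase, stepProd])
    (fun u x L L' v hx => by
      unfold momentBase
      rw [hH.integral_stepProd_cancel hν hx]) n [] r rfl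
  simpa using h2

end IsRandomBandMatrix

/-! ### The operator norm and powers of the matrix -/

section OperatorNorm

variable {N : ℕ}

theorem euclideanOpNorm_nonneg (A : Matrix (Fin N) (Fin N) ℂ) : 0 ≤ euclideanOpNorm A :=
  norm_nonneg _

theorem euclideanOpNorm_inv_smul {c : ℝ} (hc : 0 ≤ c) (A : Matrix (Fin N) (Fin N) ℂ) :
    euclideanOpNorm ((c : ℂ)⁻¹ • A) = euclideanOpNorm A / c := by
  rw [euclideanOpNorm, map_smul, norm_smul, norm_inv, Complex.norm_real, Real.norm_of_nonneg hc,
    euclideanOpNorm, div_eq_inv_mul]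

theorem euclideanOpNorm_sq_le (A : Matrix (Fin N) (Fin N) ℂ) :
    euclideanOpNorm A ^ 2 ≤ ∑ u, ∑ v, ‖A u v‖ ^ 2 := by
  have h0 : 0 ≤ ∑ u, ∑ v, ‖A u v‖ ^ 2 := by positivity
  have h1 : euclideanOpNorm A ≤ Real.sqrt (∑ u, ∑ v, ‖A u v‖ ^ 2) := by
    refine ContinuousLinearMap.opNorm_le_bound _ (Real.sqrt_nonneg _) fun x => ?_
    rw [EuclideanSpace.norm_eq, EuclideanSpace.norm_eq, ← Real.sqrt_mul h0]
    refine Real.sqrt_le_sqrt ?_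
    rw [Finset.sum_mul]
    refine Finset.sum_le_sum fun u _ => ?_
    have h2 : (Matrix.toEuclideanCLM (n := Fin N) (𝕜 := ℂ) A x) u = ∑ v, A u v * x v := rfl
    rw [h2]
    have h3 : ‖∑ v, A u v * x v‖ ≤ ∑ v, ‖A u v‖ * ‖x v‖ := by
      refine (norm_sum_le _ _).trans_eq ?_
      simp only [norm_mul]
    exact (pow_le_pow_left₀ (norm_nonneg _) h3 2).trans (Finset.sum_mul_sq_le_sq_mul_sq _ _ _)
  calc euclideanOpNorm A ^ 2 ≤ Real.sqrt (∑ u, ∑ v, ‖A u v‖ ^ 2) ^ 2 :=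
        pow_le_pow_left₀ (euclideanOpNorm_nonneg A) h1 2
    _ = _ := Real.sq_sqrt h0

/-- For self-adjoint A the C*-identity gives ‖A^(2^j)‖ = ‖A‖^(2^j), whence powers of two; the
squared Hilbert–Schmidt norm of A^(2^j) is the trace of A^(2^(j+1)). -/
theorem euclideanOpNorm_pow_le {A : Matrix (Fin N) (Fin N) ℂ} (hA : A.IsHermitian) (j : ℕ) :
    euclideanOpNorm A ^ (2 ^ (j + 1)) ≤ ∑ u, ((A ^ 2 ^ (j + 1)) u u).re := by
  have hsa : IsSelfAdjoint (Matrix.toEuclideanCLM (n := Fin N) (𝕜 := ℂ) A) :=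
    IsSelfAdjoint.map (x := A) hA (Matrix.toEuclideanCLM (n := Fin N) (𝕜 := ℂ))
  have h1 : euclideanOpNorm (A ^ 2 ^ j) = euclideanOpNorm A ^ 2 ^ j := by
    rw [euclideanOpNorm, map_pow]
    exact hsa.norm_pow_two_pow j
  rw [pow_succ, pow_mul, ← h1]
  refine (euclideanOpNorm_sq_le _).trans_eq (Finset.sum_congr rfl fun u _ => ?_)
  have hB : (A ^ 2 ^ j).IsHermitian := hA.pow _
  rw [pow_mul, pow_two, Matrix.mul_apply, Complex.re_sum]
  refine Finset.sum_congr rfl fun v _ => ?_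
  rw [← hB.apply v u, RCLike.star_def, Complex.mul_conj, Complex.ofReal_re,
    Complex.normSq_eq_norm_sq]

theorem re_pow_apply_le (A : Matrix (Fin N) (Fin N) ℂ) (n : ℕ) (r : Fin N) :
    ((A ^ n) r r).re ≤ euclideanOpNorm A ^ n := by
  set T := Matrix.toEuclideanCLM (n := Fin N) (𝕜 := ℂ) with hT
  have h1 : (T (A ^ n) (EuclideanSpace.single r 1)) r = (A ^ n) r r := by
    have h2 : (T (A ^ n) (EuclideanSpace.single r 1)) r =
        ∑ v, (A ^ n) r v * (EuclideanSpace.single r (1 : ℂ)) v := rfl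
    rw [h2]
    simp
  calc ((A ^ n) r r).re ≤ ‖(A ^ n) r r‖ := Complex.re_le_norm _
    _ ≤ ‖T (A ^ n) (EuclideanSpace.single r 1)‖ := by
        rw [← h1]
        exact PiLp.norm_apply_le _ r
    _ ≤ ‖T (A ^ n)‖ * ‖(EuclideanSpace.single r (1 : ℂ) : EuclideanSpace ℂ (Fin N))‖ :=
        ContinuousLinearMap.le_opNorm _ _
    _ = ‖(T A) ^ n‖ := by rw [map_pow]; simp
    _ ≤ ‖T A‖ ^ n := by
        have : Nontrivial (EuclideanSpace ℂ (Fin N)) := by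
          refine ⟨EuclideanSpace.single r 1, 0, fun h => ?_⟩
          have := congrArg norm h
          simp at this
        exact norm_pow_le _ _

theorem continuous_euclideanOpNorm :
    Continuous fun A : Fin N → Fin N → ℂ => euclideanOpNorm (Matrix.of A) := by
  have h1 : Continuous fun A : Fin N → Fin N → ℂ =>
      Matrix.toEuclideanCLM (n := Fin N) (𝕜 := ℂ) (Matrix.of A) := by
    let F : (Fin N → Fin N → ℂ) →ₗ[ℂ] (EuclideanSpace ℂ (Fin N) →L[ℂ] EuclideanSpace ℂ (Fin N)) :=
      { toFun := fun A => Matrix.toEuclideanCLM (n := Fin N) (𝕜 := ℂ) (Matrix.of A)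
        map_add' := fun A B => map_add (Matrix.toEuclideanCLM (n := Fin N) (𝕜 := ℂ)) _ _
        map_smul' := fun c A => map_smul (Matrix.toEuclideanCLM (n := Fin N) (𝕜 := ℂ)) c _ }
    exact F.continuous_of_finiteDimensional
  exact h1.norm

theorem IsRandomBandMatrix.measurable_euclideanOpNorm {Ω : Type*} [MeasurableSpace Ω]
    {P : Measure Ω} {ν : Measure ℂ} {W : ℝ} {H : Ω → Matrix (Fin N) (Fin N) ℂ}
    (hH : IsRandomBandMatrix P ν N W H) : Measurable fun ω => euclideanOpNorm (H ω) := by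
  have h1 : Measurable fun ω => fun u v => H ω u v :=
    measurable_pi_lambda _ fun u => measurable_pi_lambda _ fun v => hH.measurable_entry u v
  exact continuous_euclideanOpNorm.measurable.comp h1

end OperatorNorm

/-! ### From convergence in probability to convergence in distribution -/

section Distribution

/-- Convergence in probability to a constant implies convergence in distribution, for random
variables that are defined on different probability spaces. -/
theorem tendstoInDistribution_of_tendsto_tail {Ω : ℕ → Type*} [∀ N, MeasurableSpace (Ω N)]
    (P : (N : ℕ) → Measure (Ω N)) [∀ N, IsProbabilityMeasure (P N)] {Y : (N : ℕ) → Ω N → ℝ} {c : ℝ}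
    (hY : ∀ N, AEMeasurable (Y N) (P N))
    (h : ∀ ε > 0, Tendsto (fun N => (P N).real {ω | ε ≤ |Y N ω - c|}) atTop (𝓝 0)) :
    TendstoInDistribution Y atTop (fun _ : Unit => c) P (Measure.dirac ()) where
  forall_aemeasurable := hY
  aemeasurable_limit := by fun_prop
  tendsto := by
    refine ProbabilityMeasure.tendsto_iff_forall_integral_tendsto.2 fun f => ?_
    change Tendsto (fun N => ∫ x, f x ∂((P N).map (Y N))) atTop
      (𝓝 (∫ x, f x ∂((Measure.dirac ()).map fun _ : Unit => c)))
    rw [integral_map (by fun_prop) f.continuous.aestronglyMeasurable, integral_dirac]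
    simp_rw [fun N => integral_map (hY N) (f.continuous.aestronglyMeasurable (μ := (P N).map (Y N)))]
    rw [Metric.tendsto_atTop]
    intro η hη
    obtain ⟨ε, hε, hf⟩ := Metric.continuousAt_iff.1 f.continuous.continuousAt (η / 2) (by positivity)
    have h2 : Tendsto (fun N => 2 * ‖f‖ * (P N).real {ω | ε ≤ |Y N ω - c|}) atTop (𝓝 0) := by
      simpa using (h ε hε).const_mul (2 * ‖f‖)
    obtain ⟨M, hM⟩ := eventually_atTop.1 (h2.eventually_lt_const (by positivity : 0 < η / 2))
    refine ⟨M, fun N hN => ?_⟩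
    have hint : Integrable (fun ω => f (Y N ω)) (P N) :=
      Integrable.of_bound (f.continuous.comp_aestronglyMeasurable (hY N).aestronglyMeasurable) ‖f‖
        (ae_of_all _ fun ω => f.norm_coe_le_norm _)
    have hS : NullMeasurableSet {ω | ε ≤ |Y N ω - c|} (P N) :=
      nullMeasurableSet_le aemeasurable_const
        (continuous_abs.measurable.comp_aemeasurable ((hY N).sub_const c))
    have e1 : ∫ ω, f (Y N ω) ∂P N - f c = ∫ ω, (f (Y N ω) - f c) ∂P N := by
      rw [integral_sub hint (integrable_const _)]
      simp
    rw [Real.dist_eq, e1]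
    have hb : ∀ ω, |f (Y N ω) - f c| ≤
        η / 2 + {ω | ε ≤ |Y N ω - c|}.indicator (fun _ => 2 * ‖f‖) ω := by
      intro ω
      by_cases hω : ε ≤ |Y N ω - c|
      · rw [Set.indicator_of_mem (by exact hω)]
        have h5 := f.norm_coe_le_norm (Y N ω)
        have h6 := f.norm_coe_le_norm c
        rw [Real.norm_eq_abs] at h5 h6
        have := abs_sub (f (Y N ω)) (f c)
        linarith
      · rw [Set.indicator_of_notMem (by exact hω), add_zero]
        have := hf (show dist (Y N ω) c < ε by rw [Real.dist_eq]; exact not_le.1 hω)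
        rw [Real.dist_eq] at this
        exact this.le
    have hind : Integrable ({ω | ε ≤ |Y N ω - c|}.indicator fun _ => 2 * ‖f‖) (P N) :=
      (integrable_const _).indicator₀ hS
    calc |∫ ω, (f (Y N ω) - f c) ∂P N| ≤ ∫ ω, |f (Y N ω) - f c| ∂P N := abs_integral_le_integral_abs
      _ ≤ ∫ ω, (η / 2 + {ω | ε ≤ |Y N ω - c|}.indicator (fun _ => 2 * ‖f‖) ω) ∂P N :=
          integral_mono (hint.sub (integrable_const _)).abs ((integrable_const _).add hind) hb
      _ = η / 2 + 2 * ‖f‖ * (P N).real {ω | ε ≤ |Y N ω - c|} := by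
          rw [integral_add (integrable_const _) hind, integral_indicator₀ hS]
          simp
          ring
      _ < η := by linarith [hM N hN]

end Distribution

/-! ### Tail bounds for the norm -/

section Tails

variable {Ω : Type*} [MeasurableSpace Ω] {P : Measure Ω} [IsProbabilityMeasure P] {ν : Measure ℂ}
  {N : ℕ} {W : ℝ} {H : Ω → Matrix (Fin N) (Fin N) ℂ}

theorem IsRandomBandMatrix.integrable_pow_apply (hH : IsRandomBandMatrix P ν N W H)
    (hν : ν = randomSignLaw ∨ ν = randomPhaseLaw) (r : Fin N) (n : ℕ) :
    Integrable (fun ω => (H ω ^ n) r r) P := by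
  simpa [stepProd] using (hH.integral_stepProd_mul_pow_apply hν r n [] r).1

/-- The upper tail of the norm, by Markov's inequality for a trace of a power. -/
theorem IsRandomBandMatrix.upper_tail (hH : IsRandomBandMatrix P ν N W H)
    (hν : ν = randomSignLaw ∨ ν = randomPhaseLaw) (hW : 0 < W) (hWN : 2 * W ≤ N)
    {δ : ℝ} (hδ : 0 < δ) (j : ℕ) :
    P.real {ω | 2 * Real.sqrt (2 * W) * (1 + δ) ≤ euclideanOpNorm (H ω)} ≤
      N * ((1 + 3 * 2 ^ (j + 1) / (2 * W)) / (1 + δ)) ^ 2 ^ (j + 1) := by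
  set s := Real.sqrt (2 * W) with hs
  have hs0 : 0 < s := Real.sqrt_pos.2 (by linarith)
  have hs2 : s ^ 2 = 2 * W := Real.sq_sqrt (by linarith)
  set n : ℕ := 2 ^ (j + 1) with hn
  have hcard : ∀ u, ((bandNbr N W u).card : ℝ) ≤ s ^ 2 := fun u => by
    rw [hs2]; exact card_bandNbr_le hW.le hWN u
  have hi : ∀ u, Integrable (fun ω => ((H ω ^ n) u u).re) P := fun u =>
    (hH.integrable_pow_apply hν u n).re
  have hE : ∫ ω, ∑ u, ((H ω ^ n) u u).re ∂P ≤ N * ((2 + 6 * n / s ^ 2) ^ n * s ^ n) := by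
    rw [integral_finsetSum _ fun u _ => hi u]
    refine (Finset.sum_le_card_nsmul Finset.univ _ ((2 + 6 * n / s ^ 2) ^ n * s ^ n)
      fun u _ => ?_).trans_eq (by simp)
    have h1 : ∫ ω, ((H ω ^ n) u u).re ∂P = (∫ ω, (H ω ^ n) u u ∂P).re :=
      integral_re (hH.integrable_pow_apply hν u n)
    rw [h1]
    exact hH.re_integral_pow_apply_le hν hs0 hcard u n
  have hle : ∀ ω, euclideanOpNorm (H ω) ^ n ≤ ∑ u, ((H ω ^ n) u u).re := fun ω =>
    euclideanOpNorm_pow_le (hH.isHermitian ω) j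
  have hM := mul_meas_ge_le_integral_of_nonneg (μ := P)
    (f := fun ω => ∑ u, ((H ω ^ n) u u).re)
    (ae_of_all _ fun ω => (pow_nonneg (euclideanOpNorm_nonneg _) _).trans (hle ω))
    (integrable_finsetSum _ fun u _ => hi u) ((2 * s * (1 + δ)) ^ n)
  have hsub : P.real {ω | 2 * s * (1 + δ) ≤ euclideanOpNorm (H ω)} ≤
      P.real {ω | (2 * s * (1 + δ)) ^ n ≤ ∑ u, ((H ω ^ n) u u).re} :=
    measureReal_mono fun ω hω =>
      (pow_le_pow_left₀ (by positivity) hω n).trans (hle ω)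
  have hpos : 0 < (2 * s * (1 + δ)) ^ n := by positivity
  refine hsub.trans ?_
  rw [← mul_le_mul_iff_right₀ hpos]
  refine (hM.trans hE).trans_eq ?_
  rw [← hs2, div_pow]
  have e1 : (2 + 6 * (n : ℝ) / s ^ 2) = 2 * (1 + 3 * 2 ^ (j + 1) / s ^ 2) := by
    rw [hn]; push_cast; ring
  rw [e1, mul_pow, mul_pow (2 * s), mul_pow 2 s]
  field_simp

/-- The lower tail of the norm, by the second moment method for a diagonal entry of a power. -/
theorem IsRandomBandMatrix.lower_tail (hH : IsRandomBandMatrix P ν N W H)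
    (hν : ν = randomSignLaw ∨ ν = randomPhaseLaw) (hW : 2 < W) (hWN : 2 * W ≤ N)
    {l : ℝ} (hl : 0 < l) {k : ℕ} (hkl : 4 * (4 * l) ^ k ≤ (ballot (2 * k) 0 : ℝ)) :
    P.real {ω | euclideanOpNorm (H ω) ≤ 2 * Real.sqrt l * Real.sqrt (2 * W - 4)} ≤
      4 * ((2 * W / (2 * W - 4)) ^ (2 * k) * (1 + 12 * (2 * k : ℕ) ^ 2 *
        (2 + 12 * (2 * k : ℕ)) ^ (2 * (2 * k)) / (ballot (2 * k) 0 : ℝ) ^ 2 / (2 * W)) - 1) := by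
  have hN : 0 < N := by
    have : (0 : ℝ) < N := by linarith
    exact_mod_cast this
  set r : Fin N := ⟨0, hN⟩
  set s := Real.sqrt (2 * W) with hs
  -- The degree bound 2W - 3, less the one neighbour that `le_walkSum` reserves for the pop.
  set s' := Real.sqrt (2 * W - 4) with hs'
  have hs'0 : 0 < s' := Real.sqrt_pos.2 (by linarith)
  have hs2 : s ^ 2 = 2 * W := Real.sq_sqrt (by linarith)
  have hs'2 : s' ^ 2 = 2 * W - 4 := Real.sq_sqrt (by linarith)
  have hs1 : 1 ≤ s := Real.one_le_sqrt.2 (by linarith)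
  set m : ℕ := 2 * k with hm
  set G : ℝ := (ballot m 0 : ℝ) with hG
  have hG0 : 0 < G := lt_of_lt_of_le (by positivity) hkl
  set κ : ℝ := 12 * (m : ℝ) ^ 2 * (2 + 12 * (m : ℝ)) ^ (2 * m) with hκ
  set μ : ℝ := s' ^ m * G with hμ
  have hμ0 : 0 < μ := by positivity
  set T : Ω → ℝ := fun ω => ((H ω ^ m) r r).re with hT
  have hTi : Integrable T P := (hH.integrable_pow_apply hν r m).re
  have hT1 : μ ≤ ∫ ω, T ω ∂P := by
    have h1 : ∫ ω, T ω ∂P = (∫ ω, (H ω ^ m) r r ∂P).re :=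
      integral_re (hH.integrable_pow_apply hν r m)
    rw [h1]
    refine hH.le_re_integral_pow_apply hν hs'0 (fun u => ?_) r m
    have := le_card_bandNbr (by linarith) hWN u
    rw [hs'2]
    linarith
  have hsq : ∀ ω, ((H ω ^ m) r r * (H ω ^ m) r r).re = T ω ^ 2 := by
    intro ω
    have h1 : (((H ω ^ m) r r).re : ℂ) = (H ω ^ m) r r :=
      ((hH.isHermitian ω).pow m).coe_re_apply_self r
    rw [← h1, ← Complex.ofReal_mul, Complex.ofReal_re, pow_two]
  have hTc := (hH.integral_pow_apply_mul_pow_apply hν r m m).1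
  have hTi2 : Integrable (fun ω => T ω ^ 2) P := by
    have h1 : Integrable (fun ω => ((H ω ^ m) r r * (H ω ^ m) r r).re) P := hTc.re
    simpa only [hsq] using h1
  have hT2 : ∫ ω, T ω ^ 2 ∂P ≤ s ^ (2 * m) * (G ^ 2 + κ / s ^ 2) := by
    have h1 : ∫ ω, ((H ω ^ m) r r * (H ω ^ m) r r).re ∂P =
        (∫ ω, (H ω ^ m) r r * (H ω ^ m) r r ∂P).re := integral_re hTc
    simp only [hsq] at h1
    rw [h1]
    refine hH.re_integral_pow_apply_sq_le hν hs1 (fun u => ?_) r m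
    rw [hs2]
    exact card_bandNbr_le (by linarith) hWN u
  -- Here μ is only a lower bound for the mean, which is enough as -2μ E T ≤ -2μ².
  have hvar : ∫ ω, (T ω - μ) ^ 2 ∂P ≤ s ^ (2 * m) * (G ^ 2 + κ / s ^ 2) - μ ^ 2 := by
    have h1 : ∀ ω, (T ω - μ) ^ 2 = T ω ^ 2 - 2 * μ * T ω + μ ^ 2 := fun ω => by ring
    have h2 : Integrable (fun ω => T ω ^ 2 - 2 * μ * T ω) P := hTi2.sub (hTi.const_mul _)
    simp only [h1]
    rw [integral_add h2 (integrable_const _),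
      integral_sub hTi2 (hTi.const_mul _), integral_const_mul]
    simp only [integral_const, probReal_univ, one_smul]
    nlinarith
  have hvi : Integrable (fun ω => (T ω - μ) ^ 2) P := by
    have h1 : ∀ ω, (T ω - μ) ^ 2 = T ω ^ 2 - 2 * μ * T ω + μ ^ 2 := fun ω => by ring
    simp only [h1]
    exact (hTi2.sub (hTi.const_mul _)).add (integrable_const _)
  have hM := mul_meas_ge_le_integral_of_nonneg (μ := P) (f := fun ω => (T ω - μ) ^ 2)
    (ae_of_all _ fun ω => sq_nonneg _) hvi (μ ^ 2 / 4)
  have hsub : P.real {ω | euclideanOpNorm (H ω) ≤ 2 * Real.sqrt l * s'} ≤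
      P.real {ω | μ ^ 2 / 4 ≤ (T ω - μ) ^ 2} := by
    refine measureReal_mono fun ω hω => ?_
    have h1 : T ω ≤ (2 * Real.sqrt l * s') ^ m :=
      (re_pow_apply_le (H ω) m r).trans (pow_le_pow_left₀ (euclideanOpNorm_nonneg _) hω m)
    have h2 : (2 * Real.sqrt l * s') ^ m = (4 * l) ^ k * s' ^ m := by
      rw [mul_pow, hm, pow_mul, mul_pow, Real.sq_sqrt hl.le]
      norm_num
    -- The factor 4 in `hkl` forces T ≤ μ/4 on the event, which is more than the deviation μ/2
    -- needed.
    have h3 : 4 * ((4 * l) ^ k * s' ^ m) ≤ μ := by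
      have := mul_le_mul_of_nonneg_right hkl (by positivity : 0 ≤ s' ^ m)
      rw [hμ]
      linarith
    rw [h2] at h1
    have h4 : μ / 2 ≤ μ - T ω := by linarith
    change μ ^ 2 / 4 ≤ (T ω - μ) ^ 2
    nlinarith
  refine hsub.trans ?_
  have h5 := hM.trans hvar
  have hμ2 : 0 < μ ^ 2 := by positivity
  have h6 : P.real {ω | μ ^ 2 / 4 ≤ (T ω - μ) ^ 2} ≤
      4 * ((s ^ (2 * m) * (G ^ 2 + κ / s ^ 2) - μ ^ 2) / μ ^ 2) := by
    rw [← mul_le_mul_iff_right₀ (by positivity : 0 < μ ^ 2 / 4)]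
    refine h5.trans_eq ?_
    field_simp
  refine h6.trans_eq ?_
  have h7 : (2 * W / (2 * W - 4)) ^ m = s ^ (2 * m) / s' ^ (2 * m) := by
    rw [← hs'2, ← hs2, ← div_pow, ← div_pow, ← pow_mul]
  have h8 : μ ^ 2 = s' ^ (2 * m) * G ^ 2 := by rw [hμ]; ring
  rw [h7, h8, ← hs2]
  have hs0 : 0 < s := by linarith
  field_simp

end Tails

/-! ### Choice of exponents and limits -/

section Limits

variable {W : ℕ → ℝ}

theorem tendsto_atTop_of_div_log (hW : Tendsto (fun N : ℕ => W N / Real.log (N : ℝ)) atTop atTop) :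
    Tendsto W atTop atTop := by
  refine tendsto_atTop_mono' atTop ?_ hW
  have h1 : Tendsto (fun N : ℕ => Real.log (N : ℝ)) atTop atTop :=
    Real.tendsto_log_atTop.comp tendsto_natCast_atTop_atTop
  filter_upwards [h1.eventually_ge_atTop 1, hW.eventually_ge_atTop 0] with N h2 h3
  have h4 : 0 ≤ W N := by
    by_contra! h
    have := div_neg_of_neg_of_pos h (by linarith : 0 < Real.log (N : ℝ))
    linarith
  exact div_le_self h4 h2

theorem tendsto_lower_tail_bound (hW : Tendsto W atTop atTop) (m : ℕ) (c : ℝ) :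
    Tendsto (fun N => 4 * ((2 * W N / (2 * W N - 4)) ^ m * (1 + c / (2 * W N)) - 1))
      atTop (𝓝 0) := by
  have h2W : Tendsto (fun N => 2 * W N) atTop atTop := hW.const_mul_atTop (by norm_num)
  have h1 : Tendsto (fun N => c / (2 * W N)) atTop (𝓝 0) := tendsto_const_nhds.div_atTop h2W
  have h2 : Tendsto (fun N => 4 / (2 * W N)) atTop (𝓝 0) := tendsto_const_nhds.div_atTop h2W
  have h3 : Tendsto (fun N => (1 - 4 / (2 * W N))⁻¹) atTop (𝓝 1) := by
    simpa using (h2.const_sub 1).inv₀ (by norm_num)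
  have h4 : Tendsto (fun N => 2 * W N / (2 * W N - 4)) atTop (𝓝 1) := by
    refine h3.congr' ?_
    filter_upwards [hW.eventually_gt_atTop 2] with N hN
    have : 2 * W N - 4 ≠ 0 := by linarith
    have h5 : W N ≠ 0 := by linarith
    field_simp
  have h5 := (((h4.pow m).mul (h1.const_add 1)).sub_const 1).const_mul 4
  simpa using h5

/-- For a suitable exponent of order `log N`, the bound for the upper tail is at most `1 / N`. -/
theorem eventually_exists_upper_tail_bound
    (hW : Tendsto (fun N : ℕ => W N / Real.log (N : ℝ)) atTop atTop) {δ : ℝ} (hδ : 0 < δ) :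
    ∀ᶠ N : ℕ in atTop, ∃ j : ℕ,
      N * ((1 + 3 * 2 ^ (j + 1) / (2 * W N)) / (1 + δ)) ^ 2 ^ (j + 1) ≤ (1 : ℝ) / N := by
  set ρ : ℝ := (1 + δ / 2) / (1 + δ) with hρ
  have hρ0 : 0 < ρ := by positivity
  have hρ1 : ρ < 1 := by rw [hρ, div_lt_one (by positivity)]; linarith
  have hlog : 0 < -Real.log ρ := neg_pos.2 (Real.log_neg hρ0 hρ1)
  -- C is chosen so that ρ^(C log N) = N^(-2). The exponent n = 2^(j+1) satisfies C log N < n ≤ 2C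
  -- log N; the upper bound keeps 3n/(2W) below δ/2.
  set C : ℝ := 2 / -Real.log ρ with hC
  have hC0 : 0 < C := by positivity
  have h1 : Tendsto (fun N : ℕ => Real.log (N : ℝ)) atTop atTop :=
    Real.tendsto_log_atTop.comp tendsto_natCast_atTop_atTop
  filter_upwards [h1.eventually_ge_atTop (1 / C), h1.eventually_gt_atTop 0,
    hW.eventually_ge_atTop (6 * C / δ), eventually_gt_atTop 0] with N h2 h3 h4 hN
  have hN0 : (0 : ℝ) < N := by exact_mod_cast hN
  have hx : 1 ≤ C * Real.log N := by
    rw [div_le_iff₀ hC0] at h2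
    linarith
  obtain ⟨j, hj1, hj2⟩ := exists_nat_pow_near hx (by norm_num : (1 : ℝ) < 2)
  refine ⟨j, ?_⟩
  rw [le_div_iff₀ h3] at h4
  have hW0 : 0 < W N := lt_of_lt_of_le (by positivity) h4
  have h5 : 3 * (2 : ℝ) ^ (j + 1) / (2 * W N) ≤ δ / 2 := by
    rw [div_le_iff₀ (by positivity), pow_succ]
    have h6 : 6 * C / δ * Real.log N * δ ≤ W N * δ := mul_le_mul_of_nonneg_right h4 hδ.le
    have h7 : 6 * C / δ * Real.log N * δ = 6 * (C * Real.log N) := by field_simp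
    linarith
  have h6 : (1 + 3 * (2 : ℝ) ^ (j + 1) / (2 * W N)) / (1 + δ) ≤ ρ := by
    rw [hρ]
    gcongr
  have h7 : ρ ^ 2 ^ (j + 1) ≤ Real.exp (-(2 * Real.log N)) := by
    rw [← Real.exp_log hρ0, ← Real.exp_nat_mul]
    refine Real.exp_le_exp.2 ?_
    have h8 : C * Real.log N * -Real.log ρ ≤ (2 : ℝ) ^ (j + 1) * -Real.log ρ :=
      mul_le_mul_of_nonneg_right hj2.le hlog.le
    have h9 : C * Real.log N * -Real.log ρ = 2 * Real.log N := by
      rw [hC, mul_right_comm, div_mul_cancel₀ _ hlog.ne']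
    push_cast
    linarith
  have h8 : Real.exp (-(2 * Real.log N)) = 1 / (N : ℝ) ^ 2 := by
    rw [Real.exp_neg, two_mul, Real.exp_add, Real.exp_log hN0, one_div, pow_two]
  calc (N : ℝ) * ((1 + 3 * 2 ^ (j + 1) / (2 * W N)) / (1 + δ)) ^ 2 ^ (j + 1)
      ≤ N * ρ ^ 2 ^ (j + 1) := by gcongr
    _ ≤ N * (1 / (N : ℝ) ^ 2) := by rw [← h8]; gcongr
    _ = 1 / N := by field_simp

/-- After squaring, (1 - e/2)² - (1 - e)² ≥ e/4 times 2w gives at least 4, which absorbs the shift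
by 4. -/
theorem mul_sqrt_le_mul_sqrt {e w : ℝ} (he : 0 < e) (he1 : e ≤ 1) (hw : 8 / e ≤ w) :
    (1 - e) * Real.sqrt (2 * w) ≤ (1 - e / 2) * Real.sqrt (2 * w - 4) := by
  rw [div_le_iff₀ he] at hw
  have hw0 : 8 ≤ w := by nlinarith
  refine abs_le_of_sq_le_sq' ?_ (by have := Real.sqrt_nonneg (2 * w - 4); nlinarith) |>.2
  rw [mul_pow, mul_pow, Real.sq_sqrt (by linarith), Real.sq_sqrt (by linarith)]
  nlinarith [mul_nonneg he.le (by linarith : 0 ≤ 1 - e)]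

end Limits

/-! ### The convergence theorem -/

theorem theorem3 (ν : Measure ℂ) (hν : ν = randomSignLaw ∨ ν = randomPhaseLaw)
    {Ω : ℕ → Type*} [∀ N, MeasurableSpace (Ω N)]
    (P : (N : ℕ) → Measure (Ω N)) [∀ N, IsProbabilityMeasure (P N)]
    (W : ℕ → ℝ) (H : (N : ℕ) → Ω N → Matrix (Fin N) (Fin N) ℂ)
    (hH : ∀ N, IsRandomBandMatrix (P N) ν N (W N) (H N))
    (hWN : ∀ᶠ N : ℕ in atTop, 2 * W N ≤ (N : ℝ))
    (hW : Tendsto (fun N : ℕ => W N / Real.log (N : ℝ)) atTop atTop) :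
    TendstoInDistribution
      (fun (N : ℕ) (ω : Ω N) =>
        euclideanOpNorm (((2 * Real.sqrt (2 * W N) : ℝ) : ℂ)⁻¹ • H N ω))
      atTop (fun _ : Unit => (1 : ℝ)) P (Measure.dirac ()) := by
  refine tendstoInDistribution_of_tendsto_tail P (fun N => ?_) fun ε hε => ?_
  · simp only [euclideanOpNorm_inv_smul (by positivity : 0 ≤ 2 * Real.sqrt (2 * W N))]
    exact ((hH N).measurable_euclideanOpNorm.div_const _).aemeasurable
  have hWt := tendsto_atTop_of_div_log hW
  -- Capping ε at 1 keeps 1 - e nonnegative. The lower tail is applied with √l = 1 - e/2; the other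
  -- e/2 pays for replacing 2W by 2W - 4.
  set e : ℝ := min ε 1 with he
  have he0 : 0 < e := lt_min hε one_pos
  have he1 : e ≤ 1 := min_le_right _ _
  have heε : e ≤ ε := min_le_left _ _
  have hl1 : (1 - e / 2) ^ 2 < 1 := by nlinarith
  have hl0 : 0 < (1 - e / 2) ^ 2 := by
    have : 0 < 1 - e / 2 := by linarith
    positivity
  obtain ⟨k, hkl⟩ := exists_lt_ballot hl0 hl1
  have hlim := tendsto_one_div_atTop_nhds_zero_nat (𝕜 := ℝ) |>.add
    (tendsto_lower_tail_bound hWt (2 * k) (12 * (2 * k : ℕ) ^ 2 *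
        (2 + 12 * (2 * k : ℕ)) ^ (2 * (2 * k)) / (ballot (2 * k) 0 : ℝ) ^ 2))
  rw [add_zero] at hlim
  refine tendsto_of_tendsto_of_tendsto_of_le_of_le' tendsto_const_nhds hlim
    (Eventually.of_forall fun N => measureReal_nonneg) ?_
  filter_upwards [hWN, hWt.eventually_gt_atTop 2, hWt.eventually_ge_atTop (8 / e),
    eventually_exists_upper_tail_bound hW hε] with N h1 h2 h3 ⟨j, hj⟩
  have hs : 0 < 2 * Real.sqrt (2 * W N) := by
    have := Real.sqrt_pos.2 (by linarith : 0 < 2 * W N)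
    positivity
  have hsub : {ω | ε ≤ |euclideanOpNorm (((2 * Real.sqrt (2 * W N) : ℝ) : ℂ)⁻¹ • H N ω) - 1|} ⊆
      {ω | 2 * Real.sqrt (2 * W N) * (1 + ε) ≤ euclideanOpNorm (H N ω)} ∪
      {ω | euclideanOpNorm (H N ω) ≤
        2 * Real.sqrt ((1 - e / 2) ^ 2) * Real.sqrt (2 * W N - 4)} := by
    intro ω hω
    change ε ≤ |euclideanOpNorm (((2 * Real.sqrt (2 * W N) : ℝ) : ℂ)⁻¹ • H N ω) - 1| at hω
    rw [euclideanOpNorm_inv_smul hs.le] at hω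
    rcases le_abs.1 hω with h | h
    · left
      have h4 : 1 + ε ≤ euclideanOpNorm (H N ω) / (2 * Real.sqrt (2 * W N)) := by linarith
      rw [le_div_iff₀ hs] at h4
      change 2 * Real.sqrt (2 * W N) * (1 + ε) ≤ euclideanOpNorm (H N ω)
      linarith
    · right
      have h4 : euclideanOpNorm (H N ω) / (2 * Real.sqrt (2 * W N)) ≤ 1 - e := by linarith
      rw [div_le_iff₀ hs] at h4
      have h5 := mul_sqrt_le_mul_sqrt he0 he1 h3
      change euclideanOpNorm (H N ω) ≤
        2 * Real.sqrt ((1 - e / 2) ^ 2) * Real.sqrt (2 * W N - 4)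
      rw [Real.sqrt_sq (by linarith)]
      linarith
  refine (measureReal_mono hsub).trans ((measureReal_union_le _ _).trans (add_le_add ?_ ?_))
  · exact ((hH N).upper_tail hν (by linarith) h1 hε j).trans hj
  · exact (hH N).lower_tail hν h2 h1 hl0 hkl
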